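/- For a finite simple graph $G$ let $\Delta(G)$ be its maximum degree and let its $m$-degree $m(G)$ be the largest integer $i$ such that $G$ has $i$ vertices of degree at least $i-1$. A $b$-coloring of $G$ with $k$ colors is a proper coloring $c\colon V(G)\to\{1,\dots,k\}$ such that for every color $i$ there is a vertex $x_i$ with $c(x_i)=i$ that has, for every color $j\neq i$, a neighbor of color $j$. Consider the problem of deciding whether a given graph $G$ has a $b$-coloring with $m(G)$ colors, parameterized by $\Delta(G)$; as a parameterized problem it is the set $\Pi\subseteq\{0,1\}^*\times\mathbb N$ of all pairs $(x,d)$ such that $x$ is the adjacency matrix of a graph $G$ with $d=\Delta(G)$ that has a $b$-coloring with $m(G)$ colors. A kernelization algorithm for $\Pi$ is a polynomial-time algorithm that on every input $(x,d)\in\{0,1\}^*\times\mathbb N$ either correctly decides whether $(x,d)\in\Pi$, or outputs a pair $(x',d')$ with $|x'|+d'\le f(d)$ for a fixed computable function $f$, such that $(x,d)\in\Pi$ if and only if $(x',d')\in\Pi$. Then $\Pi$ admits a kernel on $O(k^4\cdot\Delta)=O(\Delta^5)$ vertices, where $k=m(G)$ and $\Delta=\Delta(G)$. That is, there are a kernelization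 algorithm for $\Pi$ and a constant $C$ such that, whenever the algorithm, given a graph $G$ together with its parameter $\Delta(G)$, does not decide the instance itself, it outputs a graph $G'$ together with its parameter $\Delta(G')$, and $$|V(G')|\le C\cdot m(G)^4\cdot\Delta(G)\qquad\text{and}\qquad |V(G')|\le C\cdot\Delta(G)^5 .$$ -/

import Mathlib

/-! ## b-colorings and the m-degree -/

namespace SimpleGraph

/-- A proper coloring `c` of `G` with the colors `Fin k` is a b-coloring if every color `i` has a
b-vertex: a vertex of color `i` that has a neighbor of every other color. -/
def IsBColoring {V : Type*} {G : SimpleGraph V} {k : ℕ} (c : G.Coloring (Fin k)) : Prop :=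
  ∀ i : Fin k, ∃ x : V, c x = i ∧ ∀ j : Fin k, j ≠ i → ∃ y : V, G.Adj x y ∧ c y = j

/-- `G` has a b-coloring with `k` colors. -/
def HasBColoring {V : Type*} (G : SimpleGraph V) (k : ℕ) : Prop :=
  ∃ c : G.Coloring (Fin k), IsBColoring c

open Classical in
/-- The maximum degree `Δ(G)` (it is `0` for the graph without vertices). -/
noncomputable def maxDeg {V : Type*} [Fintype V] (G : SimpleGraph V) : ℕ :=
  G.maxDegree

open Classical in
/-- The number of vertices `v` with `deg v ≥ i - 1` (subtraction in the integers). -/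
noncomputable def numDegGePred {V : Type*} [Fintype V] (G : SimpleGraph V) (i : ℕ) : ℕ :=
  (Finset.univ.filter fun v : V => i ≤ G.degree v + 1).card

/-- The m-degree `m(G)`: the largest `i` such that `G` has `i` vertices of degree at least
`i - 1`. -/
noncomputable def mDegree {V : Type*} [Fintype V] (G : SimpleGraph V) : ℕ :=
  sSup {i : ℕ | i ≤ G.numDegGePred i}

/-- The supremum in the definition of the m-degree is a maximum. -/
theorem mDegree_isGreatest {V : Type*} [Fintype V] (G : SimpleGraph V) :
    IsGreatest {i : ℕ | i ≤ G.numDegGePred i} G.mDegree := by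
  have hb : BddAbove {i : ℕ | i ≤ G.numDegGePred i} :=
    ⟨Fintype.card V, fun i hi => le_trans hi (Finset.card_le_univ _)⟩
  have hne : {i : ℕ | i ≤ G.numDegGePred i}.Nonempty := ⟨0, Nat.zero_le _⟩
  exact ⟨Nat.sSup_mem hne hb, fun i hi => le_csSup hb hi⟩

end SimpleGraph

/-! ## Random access machines with a step count -/

namespace RAM

/-- A configuration: registers and an indirectly addressable memory, all cells holding natural
numbers. -/
structure Config where
  reg : ℕ → ℕ
  mem : ℕ → ℕ

/-- `c.setReg r v` writes `v` into register `r`. -/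
def Config.setReg (c : Config) (r v : ℕ) : Config :=
  { c with reg := Function.update c.reg r v }

/-- `c.setMem a v` writes `v` into the memory cell with address `a`. -/
def Config.setMem (c : Config) (a v : ℕ) : Config :=
  { c with mem := Function.update c.mem a v }

/-- Random access machine programs. The only arithmetic is addition and truncated subtraction, so
the unit-cost measure below agrees with Turing machine time up to a polynomial. -/
inductive Program : Type
  /-- do nothing -/
  | skip : Program
  /-- `reg r := n` -/
  | const (r n : ℕ) : Program
  /-- `reg r := reg s + reg t` -/
  | add (r s t : ℕ) : Program
  /-- `reg r := reg s - reg t`, truncated at `0` -/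
  | sub (r s t : ℕ) : Program
  /-- `reg r := mem (reg s)` -/
  | load (r s : ℕ) : Program
  /-- `mem (reg r) := reg s` -/
  | store (r s : ℕ) : Program
  /-- first `p`, then `q` -/
  | seq (p q : Program) : Program
  /-- if `reg r ≠ 0` then `p` else `q` -/
  | cond (r : ℕ) (p q : Program) : Program
  /-- while `reg r ≠ 0` do `p` -/
  | loop (r : ℕ) (p : Program) : Program

/-- `Exec p c t d`: the program `p`, started in the configuration `c`, halts in the configuration
`d` after exactly `t` steps. Every elementary instruction and every test costs one step. -/
inductive Exec : Program → Config → ℕ → Config → Prop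
  | skip (c : Config) : Exec Program.skip c 1 c
  | const (r n : ℕ) (c : Config) : Exec (Program.const r n) c 1 (c.setReg r n)
  | add (r s t : ℕ) (c : Config) :
      Exec (Program.add r s t) c 1 (c.setReg r (c.reg s + c.reg t))
  | sub (r s t : ℕ) (c : Config) :
      Exec (Program.sub r s t) c 1 (c.setReg r (c.reg s - c.reg t))
  | load (r s : ℕ) (c : Config) : Exec (Program.load r s) c 1 (c.setReg r (c.mem (c.reg s)))
  | store (r s : ℕ) (c : Config) : Exec (Program.store r s) c 1 (c.setMem (c.reg r) (c.reg s))
  | seq {p q : Program} {c d e : Config} {t u : ℕ} (hp : Exec p c t d) (hq : Exec q d u e) :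
      Exec (Program.seq p q) c (t + u) e
  | cond_pos {r : ℕ} {p q : Program} {c d : Config} {t : ℕ} (hr : c.reg r ≠ 0)
      (hp : Exec p c t d) : Exec (Program.cond r p q) c (t + 1) d
  | cond_zero {r : ℕ} {p q : Program} {c d : Config} {t : ℕ} (hr : c.reg r = 0)
      (hq : Exec q c t d) : Exec (Program.cond r p q) c (t + 1) d
  | loop_done {r : ℕ} {p : Program} {c : Config} (hr : c.reg r = 0) :
      Exec (Program.loop r p) c 1 c
  | loop_step {r : ℕ} {p : Program} {c d e : Config} {t u : ℕ} (hr : c.reg r ≠ 0)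
      (hp : Exec p c t d) (hl : Exec (Program.loop r p) d u e) :
      Exec (Program.loop r p) c (t + u + 1) e

/-- Execution is deterministic. -/
theorem Exec.deterministic {p : Program} {c d d' : Config} {t t' : ℕ} (h : Exec p c t d)
    (h' : Exec p c t' d') : t = t' ∧ d = d' := by
  induction h generalizing t' d' with
  | skip c => cases h'; exact ⟨rfl, rfl⟩
  | const r n c => cases h'; exact ⟨rfl, rfl⟩
  | add r s t c => cases h'; exact ⟨rfl, rfl⟩
  | sub r s t c => cases h'; exact ⟨rfl, rfl⟩
  | load r s c => cases h'; exact ⟨rfl, rfl⟩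
  | store r s c => cases h'; exact ⟨rfl, rfl⟩
  | seq hp hq ihp ihq =>
    cases h' with
    | seq hp' hq' =>
      obtain ⟨rfl, rfl⟩ := ihp hp'
      obtain ⟨rfl, rfl⟩ := ihq hq'
      exact ⟨rfl, rfl⟩
  | cond_pos hr hp ih =>
    cases h' with
    | cond_pos hr' hp' =>
      obtain ⟨rfl, rfl⟩ := ih hp'
      exact ⟨rfl, rfl⟩
    | cond_zero hr' hp' => exact absurd hr' hr
  | cond_zero hr hp ih =>
    cases h' with
    | cond_pos hr' hp' => exact absurd hr hr'
    | cond_zero hr' hp' =>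
      obtain ⟨rfl, rfl⟩ := ih hp'
      exact ⟨rfl, rfl⟩
  | loop_done hr =>
    cases h' with
    | loop_done hr' => exact ⟨rfl, rfl⟩
    | loop_step hr' hp' hl' => exact absurd hr hr'
  | loop_step hr hp hl ihp ihl =>
    cases h' with
    | loop_done hr' => exact absurd hr' hr
    | loop_step hr' hp' hl' =>
      obtain ⟨rfl, rfl⟩ := ihp hp'
      obtain ⟨rfl, rfl⟩ := ihl hl'
      exact ⟨rfl, rfl⟩

end RAM

/-! ## Parameterized problems and kernelization algorithms -/

namespace Parameterized

/-- A parameterized problem over the alphabet `Bool`. -/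
abbrev Problem : Type := Set (List Bool × ℕ)

/-- What a kernelization algorithm may answer: "yes", "no", or a new instance. -/
inductive Outcome : Type
  | accept : Outcome
  | reject : Outcome
  | reduced (x : List Bool) (k : ℕ) : Outcome

/-- The size of an answer. -/
def Outcome.size : Outcome → ℕ
  | Outcome.accept => 1
  | Outcome.reject => 1
  | Outcome.reduced x k => x.length + k

/-- The input `(x, k)`: register `0` holds the length of `x`, register `1` holds `k`, memory cell
`i` holds the `i`-th bit of `x`; everything else is `0`. -/
def inputConfig (x : List Bool) (k : ℕ) : RAM.Config where
  reg := fun r => if r = 0 then x.length else if r = 1 then k else 0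
  mem := fun i => if x.getD i false = true then 1 else 0

/-- The answer in a final configuration: register `0` holds `0` for "no", `1` for "yes", and any
other value for a new instance `(x', k')`, where register `1` holds the length of `x'`, register `2`
holds `k'`, and the `i`-th bit of `x'` is set if and only if memory cell `i` is nonzero. -/
def outcomeOf (c : RAM.Config) : Outcome :=
  if c.reg 0 = 0 then Outcome.reject
  else if c.reg 0 = 1 then Outcome.accept
  else Outcome.reduced ((List.range (c.reg 1)).map fun i => decide (c.mem i ≠ 0)) (c.reg 2)

/-- On the input `(x, k)` the program `P` halts after `t` steps with the answer `o`. -/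
def Answers (P : RAM.Program) (x : List Bool) (k t : ℕ) (o : Outcome) : Prop :=
  ∃ d : RAM.Config, RAM.Exec P (inputConfig x k) t d ∧ outcomeOf d = o

/-- `P` runs in polynomial time: on every input it halts, and the number of steps together with the
size of the answer is bounded by a polynomial in the size of the input. -/
def RunsInPolyTime (P : RAM.Program) : Prop :=
  ∃ a : ℕ, ∀ (x : List Bool) (k : ℕ), ∃ (t : ℕ) (o : Outcome),
    Answers P x k t o ∧ t + o.size ≤ a * (x.length + k + 1) ^ a

/-- The answer `o` on the instance `(x, k)` of `Q` is right, and if it is a new instance `(x', k')`,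
then `|x'| + k' ≤ f k`. -/
def Outcome.IsCorrect (Q : Problem) (f : ℕ → ℕ) (x : List Bool) (k : ℕ) : Outcome → Prop
  | Outcome.accept => (x, k) ∈ Q
  | Outcome.reject => (x, k) ∉ Q
  | Outcome.reduced x' k' => x'.length + k' ≤ f k ∧ ((x, k) ∈ Q ↔ (x', k') ∈ Q)

/-- `P` is a kernelization algorithm for the parameterized problem `Q`. -/
def IsKernelization (P : RAM.Program) (Q : Problem) : Prop :=
  RunsInPolyTime P ∧
    ∃ f : ℕ → ℕ, Computable f ∧
      ∀ (x : List Bool) (k t : ℕ) (o : Outcome), Answers P x k t o → o.IsCorrect Q f x k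

open Classical in
/-- A graph on `n` vertices is written as its adjacency matrix, row by row. -/
noncomputable def encodeGraph {n : ℕ} (G : SimpleGraph (Fin n)) : List Bool :=
  List.ofFn fun i : Fin (n * n) => decide (G.Adj i.divNat i.modNat)

/-- The problem of deciding whether a graph `G` has a b-coloring with `m(G)` colors, parameterized
by the maximum degree of `G`. -/
def mDegreeBColoring : Problem :=
  {I | ∃ (n : ℕ) (G : SimpleGraph (Fin n)),
    I = (encodeGraph G, G.maxDeg) ∧ G.HasBColoring G.mDegree}

end Parameterized

/-!
Write `m` and `Δ` for the m-degree and the maximum degree of `G`. In a b-coloring with `m` colors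
every b-vertex has degree at least `m - 1`, so all b-vertices and their neighbors lie in the core:
the vertices of degree at least `m - 1` and their neighbors. The vertices outside the core have
small degree and can be colored greedily at the end; hence the subgraph induced by the core has the
same `m`, the same `Δ` and the same answer as `G`.

If the core has more than `6 * m ^ 4 * Δ` vertices, the answer is "yes". Indeed at most `m` vertices
have degree at least `m`, so there are many vertices of degree exactly `m - 1`. Without the edges at
vertices of degree at least `m` all degrees are below `m` and balls of radius 3 have at most `m ^ 3`
vertices, so one finds `m` vertices of degree `m - 1` whose closed neighborhoods are pairwise
disjoint and nonadjacent, and also disjoint from and nonadjacent to the vertices of degree at least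
`m`. Color each of these closed neighborhoods bijectively, with the `i`-th color at the `i`-th
center, and the vertices of degree at least `m` injectively; then extend greedily.

The algorithm only counts: functions computed in polynomial time by a random access machine are
closed under sums over a computed range, and degrees, `m`, `Δ`, the core and the adjacency matrix of
the subgraph that it induces are all expressed by such sums.
-/

namespace BColoring

/-! ### Closed neighborhoods and vertices of large degree -/

open SimpleGraph Finset

open scoped Classical

variable {V : Type*} [Fintype V] {G : SimpleGraph V} {k : ℕ} {u v w : V}

section Neighborhoods

variable (G)

/-- The closed neighborhood of a vertex. -/
noncomputable def closedNbhd (v : V) : Finset V := insert v (G.neighborFinset v)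

/-- The union of the closed neighborhoods of the vertices in `S`. -/
noncomputable def closedNbhdOf (S : Finset V) : Finset V := S.biUnion (closedNbhd G)

/-- The vertices of degree at least `i - 1`, the only ones that can be b-vertices in a coloring with
`i` colors. -/
noncomputable def dense (i : ℕ) : Finset V := {v | i ≤ G.degree v + 1}

/-- The vertices of degree exactly `m(G) - 1`. -/
noncomputable def tight : Finset V := {v | G.degree v + 1 = G.mDegree}

/-- The vertices of degree at least `m(G) - 1` and their neighbors; the kernel is the subgraph that
they induce. -/
noncomputable def core : Finset V := closedNbhdOf G (dense G G.mDegree)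

end Neighborhoods

theorem mem_closedNbhd : w ∈ closedNbhd G v ↔ G.Adj v w ∨ v = w := by
  simp [closedNbhd, or_comm, eq_comm]

theorem self_mem_closedNbhd : v ∈ closedNbhd G v := mem_closedNbhd.2 (.inr rfl)

theorem mem_closedNbhd_comm : w ∈ closedNbhd G v ↔ v ∈ closedNbhd G w := by
  simp only [mem_closedNbhd, G.adj_comm, eq_comm]

theorem mem_closedNbhdOf {S : Finset V} : w ∈ closedNbhdOf G S ↔ ∃ v ∈ S, w ∈ closedNbhd G v :=
  mem_biUnion

theorem card_closedNbhd : #(closedNbhd G v) = G.degree v + 1 := by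
  rw [closedNbhd, card_insert_of_notMem (by simp), card_neighborFinset_eq_degree]

theorem card_closedNbhdOf_le {S : Finset V} {b : ℕ} (h : ∀ v ∈ S, G.degree v + 1 ≤ b) :
    #(closedNbhdOf G S) ≤ #S * b :=
  card_biUnion_le_card_mul _ _ _ fun v hv => card_closedNbhd.trans_le (h v hv)

theorem mem_dense {i : ℕ} : v ∈ dense G i ↔ i ≤ G.degree v + 1 := by simp [dense]

theorem mem_tight : v ∈ tight G ↔ G.degree v + 1 = G.mDegree := by simp [tight]

theorem le_mDegree {i : ℕ} (h : i ≤ #(dense G i)) : i ≤ G.mDegree := G.mDegree_isGreatest.2 h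

theorem mDegree_le_card_dense : G.mDegree ≤ #(dense G G.mDegree) := G.mDegree_isGreatest.1

theorem le_mDegree_iff {i : ℕ} : i ≤ G.mDegree ↔ i ≤ #(dense G i) :=
  ⟨fun h => (h.trans mDegree_le_card_dense).trans <|
    card_le_card fun _ hv => mem_dense.2 (h.trans (mem_dense.1 hv)), le_mDegree⟩

theorem mDegree_le_card : G.mDegree ≤ Fintype.card V :=
  mDegree_le_card_dense.trans (card_le_univ _)

theorem card_dense_mDegree_succ_le : #(dense G (G.mDegree + 1)) ≤ G.mDegree := by
  by_contra! h
  exact (le_mDegree (Nat.succ_le_of_lt h)).not_gt (Nat.lt_succ_self _)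

theorem degree_le_maxDeg : G.degree v ≤ G.maxDeg := G.degree_le_maxDegree v

theorem exists_degree_eq_maxDeg [Nonempty V] : ∃ v, G.degree v = G.maxDeg :=
  G.exists_maximal_degree_vertex.imp fun _ => Eq.symm

theorem maxDeg_le_card : G.maxDeg ≤ Fintype.card V :=
  G.maxDegree_le_of_forall_degree_le _ fun v => card_le_univ (G.neighborFinset v)

theorem lt_maxDeg_iff {i : ℕ} : i < G.maxDeg ↔ ∃ v, i < G.degree v := by
  refine ⟨fun h => ?_, fun ⟨v, hv⟩ => hv.trans_le degree_le_maxDeg⟩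
  cases isEmpty_or_nonempty V
  · simp [maxDeg] at h
  · exact exists_degree_eq_maxDeg.imp fun _ => h.trans_eq ∘ Eq.symm

theorem mDegree_pos [Nonempty V] : 0 < G.mDegree :=
  le_mDegree (i := 1) (card_pos.2 ⟨Classical.arbitrary V, by simp [mem_dense]⟩)

theorem mDegree_le_maxDeg_succ : G.mDegree ≤ G.maxDeg + 1 := by
  rcases G.mDegree.eq_zero_or_pos with h | h
  · omega
  · obtain ⟨v, hv⟩ := card_pos.1 (h.trans_le mDegree_le_card_dense)
    exact (mem_dense.1 hv).trans (Nat.succ_le_succ degree_le_maxDeg)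

theorem mDegree_le_two_mul_maxDeg (h : 0 < G.maxDeg) : G.mDegree ≤ 2 * G.maxDeg :=
  mDegree_le_maxDeg_succ.trans (by omega)

theorem mDegree_pow_four_mul_maxDeg_le : G.mDegree ^ 4 * G.maxDeg ≤ 16 * G.maxDeg ^ 5 := by
  rcases G.maxDeg.eq_zero_or_pos with h | h
  · simp [h]
  · calc G.mDegree ^ 4 * G.maxDeg ≤ (2 * G.maxDeg) ^ 4 * G.maxDeg := by
          gcongr
          exact mDegree_le_two_mul_maxDeg h
      _ = 16 * G.maxDeg ^ 5 := by ring

/-! ### Restricting and extending b-colorings -/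

theorem exists_color_of_degree_lt (c : V → Fin k) (h : G.degree v < k) :
    ∃ a, ∀ w, G.Adj v w → c w ≠ a := by
  obtain ⟨a, -, ha⟩ := exists_mem_notMem_of_card_lt_card (s := (G.neighborFinset v).image c)
    (t := univ) (card_image_le.trans_lt (by simpa using h))
  exact ⟨a, by simpa using ha⟩

theorem exists_coloring_eqOn {P : Set V} {c : V → Fin k}
    (hc : ∀ u ∈ P, ∀ v ∈ P, G.Adj u v → c u ≠ c v) (hdeg : ∀ v ∉ P, G.degree v < k) :
    ∃ c' : G.Coloring (Fin k), Set.EqOn c' c P := by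
  suffices H : ∀ Q : Finset V, ∃ c', Set.EqOn c' c P ∧
      ∀ u ∈ P ∪ Q, ∀ v ∈ P ∪ Q, G.Adj u v → c' u ≠ c' v by
    obtain ⟨c', heq, hc'⟩ := H univ
    exact ⟨.mk c' fun {u v} => hc' u (by simp) v (by simp), heq⟩
  intro Q
  induction Q using Finset.induction_on with
  | empty => exact ⟨c, Set.eqOn_refl _ _, by simpa using hc⟩
  | insert v Q _ ih =>
    obtain ⟨c', heq, hc'⟩ := ih
    by_cases hv : v ∈ P
    · exact ⟨c', heq, by rwa [coe_insert, Set.union_insert, Set.insert_eq_self.2 (.inl hv)]⟩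
    obtain ⟨a, ha⟩ := exists_color_of_degree_lt c' (hdeg v hv)
    refine ⟨Function.update c' v a, fun w hw => ?_, fun u hu w hw huw => ?_⟩
    · rw [Function.update_of_ne (ne_of_mem_of_not_mem hw hv), heq hw]
    · rw [coe_insert, Set.union_insert] at hu hw
      rcases eq_or_ne u v with rfl | hu'
      · simpa [huw.ne'] using (ha w huw).symm
      rcases eq_or_ne w v with rfl | hw'
      · simpa [huw.ne] using ha u huw.symm
      · simpa [hu', hw'] using
          hc' u (Set.mem_of_mem_insert_of_ne hu hu') w (Set.mem_of_mem_insert_of_ne hw hw') huw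

theorem le_degree_succ_of_bVertex {c : V → Fin k} {i : Fin k}
    (h : ∀ j ≠ i, ∃ y, G.Adj v y ∧ c y = j) : k ≤ G.degree v + 1 := by
  have hsub : univ.erase i ⊆ (G.neighborFinset v).image c := fun j hj => by
    obtain ⟨y, hy⟩ := h j (ne_of_mem_erase hj)
    exact mem_image.2 ⟨y, by simpa using hy⟩
  have hcard := (card_le_card hsub).trans card_image_le
  rw [card_erase_of_mem (mem_univ i), card_fin, card_neighborFinset_eq_degree] at hcard
  omega

section Embedding

variable {W : Type*} {G' : SimpleGraph W} {e : G' ↪g G}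

theorem hasBColoring_of_embedding (h : G'.HasBColoring k)
    (hdeg : ∀ v ∉ Set.range e, G.degree v < k) : G.HasBColoring k := by
  obtain ⟨c, hc⟩ := h
  have hcolor (v : V) : Nonempty (Fin k) := by
    by_cases hv : v ∈ Set.range e
    · exact ⟨c hv.choose⟩
    · exact ⟨⟨_, hdeg v hv⟩⟩
  let d (v : V) : Fin k := (hcolor v).some
  have hext (w : W) : Function.extend e c d (e w) = c w := e.injective.extend_apply c d w
  obtain ⟨c', hc'⟩ := exists_coloring_eqOn (G := G) (P := Set.range e)
    (c := Function.extend e c d) (by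
      rintro _ ⟨u, rfl⟩ _ ⟨v, rfl⟩ huv
      rw [hext, hext]
      exact c.valid (e.map_adj_iff.1 huv)) hdeg
  have heq (w : W) : c' (e w) = c w := (hc' ⟨w, rfl⟩).trans (hext w)
  refine ⟨c', fun i => ?_⟩
  obtain ⟨x, hx, hxy⟩ := hc i
  refine ⟨e x, (heq x).trans hx, fun j hj => ?_⟩
  obtain ⟨y, hy, hyj⟩ := hxy j hj
  exact ⟨e y, e.map_adj_iff.2 hy, (heq y).trans hyj⟩

theorem hasBColoring_iff_of_embedding
    (h : (closedNbhdOf G (dense G k) : Set V) ⊆ Set.range e) :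
    G'.HasBColoring k ↔ G.HasBColoring k := by
  constructor
  · refine fun hG' => hasBColoring_of_embedding (e := e) hG' fun v hv => ?_
    by_contra! hdeg
    exact hv (h (mem_closedNbhdOf.2 ⟨v, mem_dense.2 (by omega), self_mem_closedNbhd⟩))
  · rintro ⟨c, hc⟩
    refine ⟨c.comp e.toHom, fun i => ?_⟩
    obtain ⟨x, hx, hxy⟩ := hc i
    have hdense : x ∈ dense G k := mem_dense.2 (le_degree_succ_of_bVertex hxy)
    obtain ⟨x, rfl⟩ := h (mem_closedNbhdOf.2 ⟨x, hdense, self_mem_closedNbhd⟩)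
    refine ⟨x, hx, fun j hj => ?_⟩
    obtain ⟨y, hy, hyj⟩ := hxy j hj
    obtain ⟨y, rfl⟩ := h (mem_closedNbhdOf.2 ⟨_, hdense, mem_closedNbhd.2 (.inl hy)⟩)
    exact ⟨y, e.map_adj_iff.1 hy, hyj⟩

variable [Fintype W]

theorem degree_le_of_embedding (e : G' ↪g G) (w : W) : G'.degree w ≤ G.degree (e w) :=
  e.toCopy.degree_le w

variable (h : (core G : Set V) ⊆ Set.range e)
include h

theorem exists_eq_of_mem_dense (hv : v ∈ dense G G.mDegree) :
    ∃ w, e w = v ∧ G'.degree w = G.degree v := by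
  obtain ⟨w, rfl⟩ := h (mem_closedNbhdOf.2 ⟨v, hv, self_mem_closedNbhd⟩)
  refine ⟨w, rfl, (degree_le_of_embedding e w).antisymm ?_⟩
  rw [← card_neighborFinset_eq_degree, ← card_neighborFinset_eq_degree,
    ← card_map e.toEmbedding (s := G'.neighborFinset w)]
  refine card_le_card fun u hu => ?_
  have hu : G.Adj (e w) u := by simpa using hu
  obtain ⟨u, rfl⟩ := h (mem_closedNbhdOf.2 ⟨_, hv, mem_closedNbhd.2 (.inl hu)⟩)
  simpa using hu

theorem mDegree_eq_of_embedding : G'.mDegree = G.mDegree := by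
  refine le_antisymm (le_mDegree ?_) (le_mDegree ?_)
  · refine mDegree_le_card_dense.trans
      (card_le_card_of_injOn e (fun w hw => ?_) e.injective.injOn)
    exact mem_dense.2 ((mem_dense.1 hw).trans (Nat.succ_le_succ (degree_le_of_embedding e w)))
  · refine mDegree_le_card_dense.trans ((card_le_card fun v hv => ?_).trans
      (card_map e.toEmbedding).le)
    obtain ⟨w, rfl, hw⟩ := exists_eq_of_mem_dense h hv
    exact mem_map.2 ⟨w, mem_dense.2 (hw ▸ mem_dense.1 hv), rfl⟩

theorem maxDeg_eq_of_embedding : G'.maxDeg = G.maxDeg := by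
  refine le_antisymm (G'.maxDegree_le_of_forall_degree_le _ fun w =>
    (degree_le_of_embedding e w).trans degree_le_maxDeg) ?_
  cases isEmpty_or_nonempty V
  · simp [maxDeg]
  · obtain ⟨v, hv⟩ := exists_degree_eq_maxDeg (G := G)
    obtain ⟨w, -, hw⟩ := exists_eq_of_mem_dense h (mem_dense.2 (hv ▸ mDegree_le_maxDeg_succ))
    exact hv ▸ hw ▸ degree_le_maxDeg

theorem hasBColoring_mDegree_iff_of_embedding :
    G'.HasBColoring G'.mDegree ↔ G.HasBColoring G.mDegree := by
  rw [mDegree_eq_of_embedding h]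
  exact hasBColoring_iff_of_embedding h

end Embedding

/-! ### Graphs with a large core -/

theorem exists_subset_pairwise {α : Type*} [Fintype α] {r : α → α → Prop} {b : ℕ}
    (hirrefl : ∀ x, ¬ r x x) (hsymm : ∀ x y, r x y → r y x) (hb : 0 < b)
    (hcard : ∀ x, #{y | ¬ r x y} ≤ b) {S : Finset α} {k : ℕ} (hk : k * b ≤ #S) :
    ∃ T ⊆ S, #T = k ∧ (T : Set α).Pairwise r := by
  induction k with
  | zero => exact ⟨∅, by simp⟩
  | succ k ih =>
    rw [Nat.succ_mul] at hk
    obtain ⟨T, hTS, rfl, hT⟩ := ih (by omega)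
    have hlt : #(T.biUnion fun x => {y | ¬ r x y}) < #S :=
      (card_biUnion_le_card_mul _ _ b fun x _ => hcard x).trans_lt (by omega)
    obtain ⟨y, hyS, hy⟩ := exists_mem_notMem_of_card_lt_card hlt
    have hry : ∀ x ∈ T, r x y := by simpa using hy
    exact ⟨insert y T, insert_subset hyS hTS,
      card_insert_of_notMem fun hyT => hirrefl y (hry y hyT), by
        rw [coe_insert]
        exact hT.insert fun x hx _ => ⟨hsymm _ _ (hry x hx), hry x hx⟩⟩

theorem edist_le_one_of_mem_closedNbhd (h : w ∈ closedNbhd G v) : G.edist v w ≤ 1 :=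
  edist_le_one_iff_adj_or_eq.2 (mem_closedNbhd.1 h)

theorem card_edist_le {b : ℕ} (hb : ∀ v, G.degree v + 1 ≤ b) (r : ℕ) (v : V) :
    #{w | G.edist v w ≤ r} ≤ b ^ r := by
  induction r generalizing v with
  | zero => simp [filter_eq]
  | succ r ih =>
    have hsub : ({w | G.edist v w ≤ (r + 1 : ℕ)} : Finset V) ⊆
        (closedNbhd G v).biUnion fun u => {w | G.edist u w ≤ r} := fun w hw => by
      rw [mem_filter_univ] at hw
      obtain ⟨p, hp⟩ := exists_walk_of_edist_ne_top (ne_top_of_le_ne_top (ENat.natCast_ne_top _) hw)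
      rw [← hp, Nat.cast_le] at hw
      cases p with
      | nil => exact mem_biUnion.2 ⟨v, self_mem_closedNbhd, by simp⟩
      | cons h q =>
        refine mem_biUnion.2 ⟨_, mem_closedNbhd.2 (.inl h), mem_filter_univ _ |>.2 ?_⟩
        exact (edist_le q).trans (Nat.cast_le.2 (Nat.succ_le_succ_iff.1 hw))
    calc _ ≤ #(closedNbhd G v) * b ^ r :=
          (card_le_card hsub).trans (card_biUnion_le_card_mul _ _ _ fun u _ => ih u)
      _ ≤ b * b ^ r := by
          rw [card_closedNbhd]
          exact Nat.mul_le_mul_right _ (hb v)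
      _ = b ^ (r + 1) := (pow_succ' b r).symm

variable (G) in
/-- The vertices of degree at least `m(G)`; there are at most `m(G)` of them. -/
noncomputable abbrev high : Finset V := dense G (G.mDegree + 1)

variable (G) in
/-- The subgraph of the edges without an end in `high G`. Its degrees are less than `m(G)`. -/
def lowSubgraph : SimpleGraph V where
  Adj u v := G.Adj u v ∧ u ∉ high G ∧ v ∉ high G
  symm.symm _ _ h := ⟨h.1.symm, h.2.2, h.2.1⟩
  loopless.irrefl _ h := G.irrefl h.1

theorem degree_lowSubgraph_succ_le (v : V) : (lowSubgraph G).degree v + 1 ≤ G.mDegree := by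
  by_cases hv : v ∈ high G
  · have : Nonempty V := ⟨v⟩
    have hzero : (lowSubgraph G).degree v = 0 := by
      rw [degree_eq_zero_iff_notMem_support]
      exact fun ⟨w, hw⟩ => hw.2.1 hv
    exact hzero ▸ mDegree_pos
  · have hle : (lowSubgraph G).degree v ≤ G.degree v :=
      degree_le_of_le fun _ _ h => h.1
    rw [mem_dense] at hv
    omega

theorem card_closedNbhdOf_high_le :
    #(closedNbhdOf G (high G)) ≤ G.mDegree * (G.maxDeg + 1) :=
  (card_closedNbhdOf_le fun _ _ => Nat.succ_le_succ degree_le_maxDeg).trans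
    (Nat.mul_le_mul_right _ card_dense_mDegree_succ_le)

theorem card_core_le :
    #(core G) ≤ G.mDegree * (G.maxDeg + 1) + #(tight G) * G.mDegree := by
  have hdense : dense G G.mDegree = high G ∪ tight G := by
    ext v
    rw [mem_union, mem_dense, mem_dense, mem_tight]
    omega
  rw [core, hdense, closedNbhdOf, union_biUnion]
  exact (card_union_le _ _).trans (add_le_add card_closedNbhdOf_high_le
    (card_closedNbhdOf_le fun v hv => (mem_tight.1 hv).le))

theorem le_card_tight_of_lt_card_core [Nonempty V] (hpos : 0 < G.maxDeg)
    (h : 6 * (G.mDegree ^ 4 * G.maxDeg) < #(core G)) :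
    G.mDegree ^ 2 * (G.maxDeg + 1) + G.mDegree ^ 4 ≤ #(tight G) := by
  have hcore := card_core_le (G := G)
  have hm := mDegree_le_two_mul_maxDeg hpos
  have hmpos := mDegree_pos (G := G)
  generalize G.mDegree = m, G.maxDeg = D, #(tight G) = t at *
  by_contra! ht
  refine h.not_ge (hcore.trans ?_)
  calc m * (D + 1) + t * m
      ≤ m * (2 * D) + (m ^ 2 * (2 * D) + m ^ 3 * (2 * D)) * m := by
        gcongr
        · omega
        · calc t ≤ m ^ 2 * (D + 1) + m ^ 3 * m := by rw [← pow_succ]; exact ht.le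
            _ ≤ _ := by gcongr; omega
    _ = m ^ 1 * (2 * D) + m ^ 3 * (2 * D) + m ^ 4 * (2 * D) := by ring
    _ ≤ m ^ 4 * (2 * D) + m ^ 4 * (2 * D) + m ^ 4 * (2 * D) := by
        gcongr <;> omega
    _ = 6 * (m ^ 4 * D) := by ring

theorem closedNbhd_lowSubgraph (h : v ∉ closedNbhdOf G (high G)) :
    closedNbhd (lowSubgraph G) v = closedNbhd G v := by
  simp only [mem_closedNbhdOf, not_exists, not_and] at h
  ext w
  simp only [mem_closedNbhd]
  exact or_congr_left ⟨fun hvw => hvw.1, fun hvw => ⟨hvw, fun hv => h v hv self_mem_closedNbhd,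
    fun hw => h w hw (mem_closedNbhd.2 (.inl hvw.symm))⟩⟩

theorem disjoint_closedNbhd_closedNbhdOf_high
    (h : v ∉ closedNbhdOf (lowSubgraph G) (closedNbhdOf G (high G))) :
    Disjoint (closedNbhd G v) (closedNbhdOf G (high G)) := by
  have hv : v ∉ closedNbhdOf G (high G) := fun hv =>
    h (mem_closedNbhdOf.2 ⟨v, hv, self_mem_closedNbhd⟩)
  refine Finset.disjoint_left.2 fun w hvw hw => h (mem_closedNbhdOf.2 ⟨w, hw, ?_⟩)
  rwa [mem_closedNbhd_comm, closedNbhd_lowSubgraph hv]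

theorem disjoint_closedNbhd_of_lt_edist
    (hu : Disjoint (closedNbhd G u) (closedNbhdOf G (high G)))
    (hv : Disjoint (closedNbhd G v) (closedNbhdOf G (high G)))
    (h : 3 < (lowSubgraph G).edist u v) :
    Disjoint (closedNbhd G u) (closedNbhdOf G (closedNbhd G v)) := by
  have hnear {a w : V} (hw : w ∉ closedNbhdOf G (high G)) (ha : a ∈ closedNbhd G w) :
      (lowSubgraph G).edist w a ≤ 1 :=
    edist_le_one_of_mem_closedNbhd (by rwa [closedNbhd_lowSubgraph hw])
  refine Finset.disjoint_left.2 fun a ha hav => h.not_ge ?_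
  obtain ⟨b, hb, hab⟩ := mem_closedNbhdOf.1 hav
  calc (lowSubgraph G).edist u v
      ≤ (lowSubgraph G).edist u a + (lowSubgraph G).edist a b + (lowSubgraph G).edist b v :=
        SimpleGraph.edist_triangle.trans (add_le_add_left SimpleGraph.edist_triangle _)
    _ ≤ 1 + 1 + 1 := by
        refine add_le_add (add_le_add ?_ ?_) ?_
        · exact hnear (Finset.disjoint_left.1 hu self_mem_closedNbhd) ha
        · exact hnear (Finset.disjoint_left.1 hu ha) (mem_closedNbhd_comm.1 hab)
        · rw [edist_comm]
          exact hnear (Finset.disjoint_left.1 hv self_mem_closedNbhd) hb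
    _ = 3 := by norm_num

theorem exists_subset_tight (h : G.mDegree ^ 2 * (G.maxDeg + 1) + G.mDegree ^ 4 ≤ #(tight G)) :
    ∃ T ⊆ tight G, #T = G.mDegree ∧
      (∀ v ∈ T, Disjoint (closedNbhd G v) (closedNbhdOf G (high G))) ∧
      (T : Set V).Pairwise fun u v =>
        Disjoint (closedNbhd G u) (closedNbhdOf G (closedNbhd G v)) := by
  rcases G.mDegree.eq_zero_or_pos with hm | hm
  · exact ⟨∅, by simp [hm]⟩
  set N := closedNbhdOf (lowSubgraph G) (closedNbhdOf G (high G))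
  have hN : #N ≤ G.mDegree ^ 2 * (G.maxDeg + 1) :=
    calc #N ≤ #(closedNbhdOf G (high G)) * G.mDegree :=
          card_closedNbhdOf_le fun v _ => degree_lowSubgraph_succ_le v
      _ ≤ G.mDegree * (G.maxDeg + 1) * G.mDegree :=
          Nat.mul_le_mul_right _ card_closedNbhdOf_high_le
      _ = G.mDegree ^ 2 * (G.maxDeg + 1) := by ring
  have hcard : G.mDegree * G.mDegree ^ 3 ≤ #(tight G \ N) := by
    rw [← pow_succ']
    exact (by omega : G.mDegree ^ 4 ≤ #(tight G) - #N).trans (le_card_sdiff N (tight G))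
  obtain ⟨T, hT, hTcard, hfar⟩ := exists_subset_pairwise
    (r := fun u v => 3 < (lowSubgraph G).edist u v) (by simp)
    (fun u v => by simp only [SimpleGraph.edist_comm, imp_self]) (pow_pos hm 3)
    (by simpa using card_edist_le degree_lowSubgraph_succ_le 3) hcard
  have hhigh : ∀ v ∈ T, Disjoint (closedNbhd G v) (closedNbhdOf G (high G)) := fun v hv =>
    disjoint_closedNbhd_closedNbhdOf_high (mem_sdiff.1 (hT hv)).2
  exact ⟨T, hT.trans sdiff_subset, hTcard, hhigh, fun u hu v hv huv =>
    disjoint_closedNbhd_of_lt_edist (hhigh u hu) (hhigh v hv) (hfar hu hv huv)⟩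

theorem disjoint_closedNbhdOf_comm {A B : Finset V} :
    Disjoint A (closedNbhdOf G B) ↔ Disjoint B (closedNbhdOf G A) := by
  simp only [Finset.disjoint_left, mem_closedNbhdOf, not_exists, not_and]
  exact ⟨fun h b hb a ha hba => h ha b hb (mem_closedNbhd_comm.1 hba),
    fun h a ha b hb hab => h hb a ha (mem_closedNbhd_comm.1 hab)⟩

theorem exists_coloring_of_separated {ι : Type*} {B : ι → Finset V} {k : ℕ}
    {g : ∀ i, B i → Fin k} (hg : ∀ i, (g i).Injective)
    (hsep : Pairwise fun i j => Disjoint (B i) (closedNbhdOf G (B j)))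
    (hdeg : ∀ v, (∀ i, v ∉ B i) → G.degree v < k) :
    ∃ c : G.Coloring (Fin k), ∀ i (v : B i), c v = g i v := by
  have heq {i j : ι} {u v : V} (hu : u ∈ B i) (hv : v ∈ B j) (huv : u ∈ closedNbhd G v) :
      i = j := by
    by_contra hij
    exact Finset.disjoint_left.1 (hsep hij) hu (mem_closedNbhdOf.2 ⟨v, hv, huv⟩)
  let c (v : V) : Fin k :=
    if h : ∃ i, v ∈ B i then g h.choose ⟨v, h.choose_spec⟩
    else ⟨G.degree v, hdeg v (not_exists.1 h)⟩
  have hc {i : ι} {v : V} (hv : v ∈ B i) : c v = g i ⟨v, hv⟩ := by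
    have h : ∃ i, v ∈ B i := ⟨i, hv⟩
    rw [show c v = g h.choose ⟨v, h.choose_spec⟩ from dif_pos h]
    have hi := heq h.choose_spec hv self_mem_closedNbhd
    subst hi
    rfl
  obtain ⟨c', hc'⟩ := exists_coloring_eqOn (G := G) (P := {v | ∃ i, v ∈ B i}) (c := c) (by
    rintro u ⟨i, hu⟩ v ⟨j, hv⟩ huv
    obtain rfl := heq hu hv (mem_closedNbhd.2 (.inl huv.symm))
    rw [hc hu, hc hv]
    exact (hg i).ne fun h => huv.ne (congrArg Subtype.val h)) fun v hv => hdeg v (not_exists.1 hv)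
  exact ⟨c', fun i v => (hc' ⟨i, v.2⟩).trans (hc v.2)⟩

theorem hasBColoring_of_separated {k : ℕ} {x : Fin k → V} (hx : ∀ i, G.degree (x i) + 1 = k)
    (hcard : #(dense G (k + 1)) ≤ k)
    (hhigh : ∀ i, Disjoint (closedNbhd G (x i)) (closedNbhdOf G (dense G (k + 1))))
    (hfar : Pairwise fun i j =>
      Disjoint (closedNbhd G (x i)) (closedNbhdOf G (closedNbhd G (x j)))) :
    G.HasBColoring k := by
  let g (i : Fin k) : closedNbhd G (x i) ≃ Fin k :=
    (equivFinOfCardEq (card_closedNbhd.trans (hx i))).setValue ⟨x i, self_mem_closedNbhd⟩ i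
  obtain ⟨f⟩ : Nonempty (dense G (k + 1) ↪ Fin k) :=
    Function.Embedding.nonempty_of_card_le (by simpa using hcard)
  obtain ⟨c, hc⟩ := exists_coloring_of_separated (G := G)
    (B := fun o : Option (Fin k) => o.elim (dense G (k + 1)) fun i => closedNbhd G (x i))
    (g := Option.rec f fun i => g i) (Option.forall.2 ⟨f.injective, fun i => (g i).injective⟩)
    (by
      rintro (_ | i) (_ | j) hij
      · exact absurd rfl hij
      · exact disjoint_closedNbhdOf_comm.1 (hhigh j)
      · exact hhigh i
      · exact hfar fun h => hij (congrArg some h))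
    (fun v hv => by simpa [mem_dense] using hv none)
  have hcx (i : Fin k) : c (x i) = i :=
    (hc (some i) ⟨x i, self_mem_closedNbhd⟩).trans (Equiv.setValue_eq ..)
  refine ⟨c, fun i => ⟨x i, hcx i, fun j hj => ?_⟩⟩
  obtain ⟨⟨y, hy⟩, hyj⟩ := (g i).surjective j
  have hcy : c y = j := (hc (some i) ⟨y, hy⟩).trans hyj
  refine ⟨y, (mem_closedNbhd.1 hy).resolve_right ?_, hcy⟩
  rintro rfl
  exact hj (hcy.symm.trans (hcx i))

theorem hasBColoring_mDegree_of_maxDeg_eq_zero [Nonempty V] (h : G.maxDeg = 0) :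
    G.HasBColoring G.mDegree := by
  have hm : G.mDegree = 1 :=
    (mDegree_le_maxDeg_succ.trans_eq (congrArg Nat.succ h)).antisymm mDegree_pos
  have hadj {u v : V} : ¬ G.Adj u v := fun huv =>
    (((G.degree_pos_iff_exists_adj u).2 ⟨v, huv⟩).trans_le degree_le_maxDeg).ne' h
  rw [hm]
  exact ⟨.mk (fun _ => 0) fun huv => absurd huv hadj, fun i => ⟨Classical.arbitrary V,
    Subsingleton.elim _ _, fun j hj => absurd (Subsingleton.elim _ _) hj⟩⟩

theorem hasBColoring_of_lt_card_core (h : 6 * (G.mDegree ^ 4 * G.maxDeg) < #(core G)) :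
    G.HasBColoring G.mDegree := by
  have : Nonempty V := (card_pos.1 (Nat.zero_lt_of_lt h)).to_type
  rcases G.maxDeg.eq_zero_or_pos with hD | hD
  · exact hasBColoring_mDegree_of_maxDeg_eq_zero hD
  · obtain ⟨T, hT, hcard, hhigh, hfar⟩ := exists_subset_tight (le_card_tight_of_lt_card_core hD h)
    let x := (T.equivFinOfCardEq hcard).symm
    exact hasBColoring_of_separated (fun i => mem_tight.1 (hT (x i).2)) card_dense_mDegree_succ_le
      (fun i => hhigh _ (x i).2) fun i j hij => hfar (x i).2 (x j).2
        (Subtype.coe_injective.ne (x.injective.ne hij))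

end BColoring

namespace RAM

/-! ### Running times -/

/-- Started in `c`, the program `p` halts after at most `T` steps in a configuration with `Q`. -/
def Runs (p : Program) (c : Config) (T : ℕ) (Q : Config → Prop) : Prop :=
  ∃ t d, Exec p c t d ∧ t ≤ T ∧ Q d

namespace Runs

variable {p q : Program} {c d : Config} {t T U : ℕ} {Q R : Config → Prop}

theorem of_exec (h : Exec p c t d) (hd : Q d) : Runs p c t Q :=
  ⟨t, d, h, le_rfl, hd⟩

theorem mono (h : Runs p c T Q) (hT : T ≤ U) (hQ : ∀ d, Q d → R d) : Runs p c U R := by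
  obtain ⟨t, d, hexec, ht, hd⟩ := h
  exact ⟨t, d, hexec, ht.trans hT, hQ d hd⟩

theorem seq (hp : Runs p c T Q) (hq : ∀ d, Q d → Runs q d U R) :
    Runs (.seq p q) c (T + U) R := by
  obtain ⟨t, d, hpd, ht, hd⟩ := hp
  obtain ⟨u, e, hqe, hu, he⟩ := hq d hd
  exact ⟨t + u, e, hpd.seq hqe, add_le_add ht hu, he⟩

theorem exec_seq (hp : Exec p c t d) (hq : Runs q d U R) : Runs (.seq p q) c (t + U) R :=
  (of_exec (Q := (· = d)) hp rfl).seq fun _ h => h ▸ hq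

theorem loop_of_countdown {r n : ℕ} {I : ℕ → Config → Prop} (h0 : I 0 c) (hr : c.reg r = n)
    (step : ∀ j < n, ∀ d, I j d → d.reg r = n - j →
      Runs p d T fun e => I (j + 1) e ∧ e.reg r = n - (j + 1)) :
    Runs (.loop r p) c (n * (T + 1) + 1) (I n) := by
  suffices H : ∀ k j c, j + k = n → I j c → c.reg r = n - j →
      Runs (.loop r p) c (k * (T + 1) + 1) (I n) from H n 0 c (zero_add n) h0 hr
  intro k
  induction k with
  | zero =>
    intro j c hj hI hc
    obtain rfl : j = n := hj
    exact ⟨1, c, .loop_done (by simpa using hc), by omega, hI⟩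
  | succ k ih =>
    intro j c hj hI hc
    obtain ⟨t, d, hcd, ht, hd, hdr⟩ := step j (by omega) c hI hc
    obtain ⟨u, e, hde, hu, he⟩ := ih (j + 1) d (by omega) hd hdr
    refine ⟨t + u + 1, e, .loop_step (by omega) hcd hde, ?_, he⟩
    rw [Nat.succ_mul]
    omega

end Runs

namespace Config

variable (c : Config) (r s v a b : ℕ)

@[simp] theorem setReg_reg : (c.setReg r v).reg s = if s = r then v else c.reg s := by
  simp [setReg, Function.update_apply]

@[simp] theorem setReg_mem : (c.setReg r v).mem = c.mem := rfl

@[simp] theorem setMem_reg : (c.setMem a v).reg = c.reg := rfl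

@[simp] theorem setMem_mem : (c.setMem a v).mem b = if b = a then v else c.mem b := by
  simp [setMem, Function.update_apply]

end Config

/-- `reg r := reg s`, for `s ≠ r`. -/
def copy (r s : ℕ) : Program := .seq (.const r 0) (.add r r s)

theorem exec_copy {r s : ℕ} (hsr : s ≠ r) (c : Config) :
    Exec (copy r s) c 2 (c.setReg r (c.reg s)) := by
  have h : (c.setReg r 0).setReg r ((c.setReg r 0).reg r + (c.setReg r 0).reg s) =
      c.setReg r (c.reg s) := by
    simp only [Config.setReg_reg, if_neg hsr, if_pos, zero_add]
    simp [Config.setReg]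
  exact h ▸ Exec.seq (.const r 0 c) (.add r r s _)

/-- With the number of rounds in register `r`, repeat `p`; register `r + 1` holds the number of the
current round and register `r + 2` holds the decrement of the counter. -/
def forLoop (r : ℕ) (p : Program) : Program :=
  .seq (.const (r + 1) 0) <| .seq (.const (r + 2) 1) <|
    .loop r <| .seq p <| .seq (.add (r + 1) (r + 1) (r + 2)) (.sub r r (r + 2))

theorem forLoop_runs {r : ℕ} {p : Program} {c : Config} {T : ℕ} {I : ℕ → Config → Prop}
    (hI : ∀ j d s x, r ≤ s → s ≤ r + 2 → I j d → I j (d.setReg s x)) (h0 : I 0 c)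
    (step : ∀ j < c.reg r, ∀ d, I j d → d.reg (r + 1) = j →
      Runs p d T fun e => I (j + 1) e ∧ ∀ s, r ≤ s → s ≤ r + 2 → e.reg s = d.reg s) :
    Runs (forLoop r p) c (c.reg r * (T + 3) + 3) (I (c.reg r)) := by
  refine Runs.mono (T := 1 + (1 + (c.reg r * (T + 2 + 1) + 1))) ?_ (by ring_nf; omega) fun _ h => h
  refine .exec_seq (.const ..) <| .exec_seq (.const ..) <| .mono (Runs.loop_of_countdown
    (I := fun j d => I j d ∧ d.reg (r + 1) = j ∧ d.reg (r + 2) = 1)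
    ⟨hI _ _ _ _ (by omega) le_rfl (hI _ _ _ _ (by omega) (by omega) h0), by simp, by simp⟩
    (by simp) ?_) le_rfl fun _ h => h.1
  rintro j hj d ⟨hd, hindex, hone⟩ hcount
  refine (step j hj d hd hindex).seq fun e ⟨he, hregs⟩ =>
    .exec_seq (.add ..) <| .of_exec (.sub ..) ⟨⟨?_, ?_, ?_⟩, ?_⟩
  · exact hI _ _ _ _ le_rfl (by omega) (hI _ _ _ _ (by omega) (by omega) he)
  · simp [hregs (r + 1), hregs (r + 2), hindex, hone]
  · simp [hregs (r + 2), hone]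
  · simp [hregs r, hregs (r + 2), hcount, hone]
    omega

/-- `d` has the memory of `c` and, below `r`, the registers of `c`. -/
structure AgreeBelow (r : ℕ) (c d : Config) : Prop where
  mem : d.mem = c.mem
  reg : ∀ s < r, d.reg s = c.reg s

namespace AgreeBelow

variable {r s : ℕ} {c d e : Config}

theorem refl (r : ℕ) (c : Config) : AgreeBelow r c c := ⟨rfl, fun _ _ => rfl⟩

theorem trans (h : AgreeBelow r c d) (h' : AgreeBelow r d e) : AgreeBelow r c e :=
  ⟨h'.mem.trans h.mem, fun s hs => (h'.reg s hs).trans (h.reg s hs)⟩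

theorem anti (h : AgreeBelow s c d) (hrs : r ≤ s) : AgreeBelow r c d :=
  ⟨h.mem, fun i hi => h.reg i (hi.trans_le hrs)⟩

theorem setReg (h : AgreeBelow r c d) (hrs : r ≤ s) (x : ℕ) : AgreeBelow r c (d.setReg s x) :=
  ⟨h.mem, fun i hi => by simp [(hi.trans_le hrs).ne, h.reg i hi]⟩

end AgreeBelow

/-- With the number of summands in register `r`, add up the values that `p` computes in register
`r + 4` from the index in register `r + 1`, and put the sum into register `r`. -/
def sumLoop (r : ℕ) (p : Program) : Program :=
  .seq (.const (r + 3) 0) <| .seq (forLoop r (.seq p (.add (r + 3) (r + 3) (r + 4)))) <|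
    copy r (r + 3)

theorem sumLoop_runs {r : ℕ} {p : Program} {c : Config} {T : ℕ} {g : ℕ → ℕ}
    (hp : ∀ j < c.reg r, ∀ d, AgreeBelow r c d → d.reg (r + 1) = j →
      Runs p d T fun e => AgreeBelow (r + 4) d e ∧ e.reg (r + 4) = g j) :
    Runs (sumLoop r p) c (c.reg r * (T + 4) + 6) fun d =>
      AgreeBelow r c d ∧ d.reg r = ∑ j ∈ Finset.range (c.reg r), g j := by
  have hcount : (c.setReg (r + 3) 0).reg r = c.reg r := by simp
  refine Runs.mono (T := 1 + (c.reg r * (T + 1 + 3) + 3 + 2)) ?_ (by ring_nf; omega) fun _ h => h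
  refine .exec_seq (.const ..) <| .seq (hcount ▸ forLoop_runs
    (I := fun j d => AgreeBelow r c d ∧ d.reg (r + 3) = ∑ i ∈ Finset.range j, g i) ?_
    ⟨(AgreeBelow.refl r c).setReg (by omega) 0, by simp⟩ ?_)
    fun d hd => .of_exec (exec_copy (by omega) d) ⟨hd.1.setReg le_rfl _, by simpa using hd.2⟩
  · rintro j d s x hrs hs ⟨hagree, hsum⟩
    exact ⟨hagree.setReg hrs x, by simpa [show r + 3 ≠ s by omega] using hsum⟩
  · rintro j hj d ⟨hagree, hsum⟩ hindex
    refine (hp j (hcount ▸ hj) d hagree hindex).seq fun e ⟨he, hval⟩ =>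
      .of_exec (.add ..) ⟨⟨?_, ?_⟩, fun s hrs hs => ?_⟩
    · exact (hagree.trans (he.anti (by omega))).setReg (by omega) _
    · simp [he.reg (r + 3), hsum, hval, Finset.sum_range_succ]
    · simp [show s ≠ r + 3 by omega, he.reg s (by omega)]

/-! ### Polynomial-time functions -/

open Polynomial

/-- What a program computes from: a read-only word and natural-number variables, one of which is
the length of the word. -/
class Environment (α : Type) where
  word : α → List Bool
  vars : α → ℕ → ℕ
  exists_var_eq_length : ∃ i, ∀ a, vars a i = (word a).length

open Environment

/-- The sequence `v` with `s` put in front. -/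
def push (s : ℕ) (v : ℕ → ℕ) : ℕ → ℕ
  | 0 => s
  | i + 1 => v i

/-- The variables of an instance `(x, k)` are `k` and the length of `x`. -/
instance : Environment (List Bool × ℕ) where
  word I := I.1
  vars I := push I.2 fun _ => I.1.length
  exists_var_eq_length := ⟨1, fun _ => rfl⟩

/-- A bounded index is one more variable. -/
instance {α : Type} [Environment α] {n : α → ℕ} : Environment (Σ a, Fin (n a)) where
  word s := word s.1
  vars s := push s.2 (vars s.1)
  exists_var_eq_length := exists_var_eq_length.imp' (· + 1) fun _ h s => h s.1

section

variable {α : Type} [Environment α]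

/-- The memory of `c` holds the word of `a`, and register `v i`, which is below `r`, holds the
`i`-th variable of `a`. -/
structure Stored (a : α) (v : ℕ → ℕ) (r : ℕ) (c : Config) : Prop where
  mem : ∀ i < (word a).length, c.mem i = if (word a).getD i false = true then 1 else 0
  lt : ∀ i, v i < r
  reg : ∀ i, c.reg (v i) = vars a i

namespace Stored

variable {a : α} {v : ℕ → ℕ} {r s : ℕ} {c d : Config}

theorem of_agreeBelow (h : Stored a v r c) (hcd : AgreeBelow r c d) (hrs : r ≤ s) :
    Stored a v s d :=
  ⟨hcd.mem ▸ h.mem, fun i => (h.lt i).trans_le hrs, fun i => by rw [hcd.reg _ (h.lt i), h.reg]⟩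

theorem push {n : α → ℕ} {j : Fin (n a)} (h : Stored a v r c) (hs : s < r) (hj : c.reg s = j) :
    Stored (⟨a, j⟩ : Σ a, Fin (n a)) (push s v) r c :=
  ⟨h.mem, Nat.rec hs fun i _ => h.lt i, Nat.rec hj fun i _ => h.reg i⟩

theorem fst {n : α → ℕ} {b : Σ a, Fin (n a)} (h : Stored b v r c) :
    Stored b.1 (fun i => v (i + 1)) r c :=
  ⟨h.mem, fun i => h.lt (i + 1), fun i => h.reg (i + 1)⟩

end Stored

/-- `f` is computed by a program whose running time and result are bounded by a polynomial in any
bound on the variables. The program may be placed above any registers: `v` says where the variables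
are, and the registers below `r` are left alone. -/
def PolyTime (f : α → ℕ) : Prop :=
  ∃ (p : (ℕ → ℕ) → ℕ → Program) (T : ℕ[X]), ∀ a N, (∀ i, vars a i ≤ N) → f a ≤ T.eval N ∧
    ∀ v r c, Stored a v r c →
      Runs (p v r) c (T.eval N) fun d => AgreeBelow r c d ∧ d.reg r = f a

open Classical in
/-- `p` has a polynomial-time characteristic function. -/
def PolyTimePred (p : α → Prop) : Prop :=
  PolyTime fun a => if p a then 1 else 0

namespace PolyTime

variable {f g : α → ℕ} {n : α → ℕ} {p : α → Prop}

theorem const (m : ℕ) : PolyTime fun _ : α => m :=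
  ⟨fun _ r => .const r m, C m + 1, fun _ _ _ => ⟨by simp, fun _ r c _ =>
    .mono (.of_exec (.const r m c) ⟨(AgreeBelow.refl r c).setReg le_rfl m, by simp⟩) (by simp)
      fun _ h => h⟩⟩

theorem var (i : ℕ) : PolyTime fun a : α => vars a i :=
  ⟨fun v r => copy r (v i), X + 2, fun a N hN => ⟨by simpa using (hN i).trans (by omega),
    fun v r c hc => .mono (.of_exec (exec_copy (hc.lt i).ne c)
      ⟨(AgreeBelow.refl r c).setReg le_rfl _, by simp [hc.reg]⟩) (by simp) fun _ h => h⟩⟩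

theorem length_word : PolyTime fun a : α => (word a).length := by
  obtain ⟨i, hi⟩ := exists_var_eq_length (α := α)
  simpa only [hi] using var (α := α) i

theorem fst (hf : PolyTime f) : PolyTime fun s : Σ a, Fin (n a) => f s.1 := by
  obtain ⟨p, T, hp⟩ := hf
  refine ⟨fun v => p fun i => v (i + 1), T, fun s N hN => ?_⟩
  obtain ⟨hval, hrun⟩ := hp s.1 N fun i => hN (i + 1)
  exact ⟨hval, fun v r c hc => hrun _ r c hc.fst⟩

theorem index : PolyTime fun s : Σ a, Fin (n a) => (s.2 : ℕ) := var 0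

theorem map₂ {op : ℕ → ℕ → ℕ} {instr : ℕ → ℕ → ℕ → Program}
    (hinstr : ∀ r s t c, Exec (instr r s t) c 1 (c.setReg r (op (c.reg s) (c.reg t))))
    (hop : ∀ x y, op x y ≤ x + y) (hf : PolyTime f) (hg : PolyTime g) :
    PolyTime fun a => op (f a) (g a) := by
  obtain ⟨p, T, hp⟩ := hf
  obtain ⟨q, U, hq⟩ := hg
  refine ⟨fun v r => .seq (p v r) (.seq (q v (r + 1)) (instr r r (r + 1))), T + (U + 1),
    fun a N hN => ?_⟩
  obtain ⟨hf_le, hp⟩ := hp a N hN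
  obtain ⟨hg_le, hq⟩ := hq a N hN
  refine ⟨?_, fun v r c hc => ?_⟩
  · simpa using (hop _ _).trans (by omega)
  simp only [eval_add, eval_one]
  refine (hp v r c hc).seq fun d ⟨hcd, hd⟩ =>
    (hq v (r + 1) d (hc.of_agreeBelow hcd r.le_succ)).seq fun e ⟨hde, he⟩ =>
      .of_exec (hinstr ..) ⟨(hcd.trans (hde.anti r.le_succ)).setReg le_rfl _, ?_⟩
  simp [hde.reg r r.lt_succ_self, hd, he]

theorem add (hf : PolyTime f) (hg : PolyTime g) : PolyTime fun a => f a + g a :=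
  map₂ .add (fun _ _ => le_rfl) hf hg

theorem sub (hf : PolyTime f) (hg : PolyTime g) : PolyTime fun a => f a - g a :=
  map₂ .sub (fun _ _ => by omega) hf hg

open Classical in
theorem ite (hp : PolyTimePred p) (hf : PolyTime f) (hg : PolyTime g) :
    PolyTime fun a => if p a then f a else g a := by
  obtain ⟨test, S, htest⟩ := hp
  obtain ⟨yes, T, hyes⟩ := hf
  obtain ⟨no, U, hno⟩ := hg
  refine ⟨fun v r => .seq (test v r) (.cond r (yes v r) (no v r)), S + (T + U + 1),
    fun a N hN => ?_⟩
  obtain ⟨-, htest⟩ := htest a N hN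
  obtain ⟨hf_le, hyes⟩ := hyes a N hN
  obtain ⟨hg_le, hno⟩ := hno a N hN
  refine ⟨?_, fun v r c hc => ?_⟩
  · simp only [eval_add, eval_one]
    split_ifs <;> omega
  simp only [eval_add, eval_one]
  refine (htest v r c hc).seq fun d ⟨hcd, hd⟩ => ?_
  have hstored := hc.of_agreeBelow hcd le_rfl
  by_cases ha : p a
  · obtain ⟨t, e, hexec, ht, hde, he⟩ := hyes v r d hstored
    exact ⟨t + 1, e, .cond_pos (by simp [hd, ha]) hexec, by omega, hcd.trans hde, by simp [he, ha]⟩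
  · obtain ⟨t, e, hexec, ht, hde, he⟩ := hno v r d hstored
    exact ⟨t + 1, e, .cond_zero (by simp [hd, ha]) hexec, by omega, hcd.trans hde, by simp [he, ha]⟩

theorem sum {f : ∀ a, Fin (n a) → ℕ} (hn : PolyTime n)
    (hf : PolyTime fun s : Σ a, Fin (n a) => f s.1 s.2) : PolyTime fun a => ∑ i, f a i := by
  obtain ⟨p, T, hp⟩ := hn
  obtain ⟨q, U, hq⟩ := hf
  refine ⟨fun v r => .seq (p v r) (sumLoop r (q (push (r + 1) v) (r + 4))),
    T + (T * (U.comp (X + T) + 4) + 6), fun a N hN => ?_⟩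
  obtain ⟨hn_le, hp⟩ := hp a N hN
  have hN' (j : Fin (n a)) : ∀ i, vars (⟨a, j⟩ : Σ a, Fin (n a)) i ≤ N + T.eval N :=
    Nat.rec (show (j : ℕ) ≤ _ by omega) fun i _ => (hN i).trans (by omega)
  simp only [eval_add, eval_mul, eval_comp, eval_X, eval_ofNat]
  refine ⟨?_, fun v r c hc => ?_⟩
  · have hsum : ∑ i, f a i ≤ n a * U.eval (N + T.eval N) := by
      simpa using Finset.sum_le_card_nsmul Finset.univ (f a) _ fun i _ => (hq ⟨a, i⟩ _ (hN' i)).1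
    have hmul : n a * U.eval (N + T.eval N) ≤ T.eval N * (U.eval (N + T.eval N) + 4) :=
      Nat.mul_le_mul hn_le (by omega)
    omega
  refine (hp v r c hc).seq fun d ⟨hcd, hd⟩ => ?_
  refine Runs.mono (sumLoop_runs (g := fun j => if h : j < n a then f a ⟨j, h⟩ else 0)
    (T := U.eval (N + T.eval N)) fun j hj e hde he => ?_) ?_ fun e ⟨hde, he⟩ => ⟨hcd.trans hde, ?_⟩
  · rw [hd] at hj
    simp only [dif_pos hj]
    have hstored := hc.of_agreeBelow (hcd.trans hde) (show r ≤ r + 4 by omega)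
    exact (hq ⟨a, ⟨j, hj⟩⟩ _ (hN' _)).2 _ _ e (hstored.push (by omega) he)
  · rw [hd]
    gcongr
  · rw [he, hd, Finset.sum_range]
    simp

theorem mul (hf : PolyTime f) (hg : PolyTime g) : PolyTime fun a => f a * g a := by
  simpa using hf.sum (f := fun a _ => g a) hg.fst

end PolyTime

namespace PolyTimePred

variable {f g : α → ℕ} {p q : α → Prop} {n : α → ℕ}

theorem congr (hp : PolyTimePred p) (h : ∀ a, p a ↔ q a) : PolyTimePred q :=
  funext (fun a => propext (h a)) ▸ hp

theorem fst (hp : PolyTimePred p) : PolyTimePred fun s : Σ a, Fin (n a) => p s.1 :=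
  PolyTime.fst hp

theorem getD_word (hf : PolyTime f) (hlt : ∀ a, f a < (word a).length) :
    PolyTimePred fun a => (word a).getD (f a) false = true := by
  obtain ⟨p, T, hp⟩ := hf
  refine ⟨fun v r => .seq (p v r) (.load r r), T + 1, fun a N hN => ⟨?_, fun v r c hc => ?_⟩⟩
  · simp only [eval_add, eval_one]
    split_ifs <;> omega
  · simp only [eval_add, eval_one]
    refine ((hp a N hN).2 v r c hc).seq fun d ⟨hcd, hd⟩ =>
      .of_exec (.load ..) ⟨hcd.setReg le_rfl _, ?_⟩
    simp [hd, hcd.mem, hc.mem _ (hlt a)]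

theorem le (hf : PolyTime f) (hg : PolyTime g) : PolyTimePred fun a => f a ≤ g a := by
  unfold PolyTimePred
  convert (PolyTime.const 1).sub (hf.sub hg) using 2
  split_ifs <;> omega

theorem lt (hf : PolyTime f) (hg : PolyTime g) : PolyTimePred fun a => f a < g a :=
  le (hf.add (.const 1)) hg

theorem not (hp : PolyTimePred p) : PolyTimePred fun a => ¬ p a := by
  unfold PolyTimePred
  convert (PolyTime.const 0).ite hp (.const 1) using 2
  split_ifs <;> tauto

theorem and (hp : PolyTimePred p) (hq : PolyTimePred q) : PolyTimePred fun a => p a ∧ q a := by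
  unfold PolyTimePred
  convert PolyTime.ite hp hq (.const 0) using 2
  split_ifs <;> tauto

theorem or (hp : PolyTimePred p) (hq : PolyTimePred q) : PolyTimePred fun a => p a ∨ q a :=
  (hp.not.and hq.not).not.congr fun _ => by tauto

theorem iff (hp : PolyTimePred p) (hq : PolyTimePred q) : PolyTimePred fun a => p a ↔ q a :=
  ((hp.and hq).or (hp.not.and hq.not)).congr fun _ => by tauto

theorem eq (hf : PolyTime f) (hg : PolyTime g) : PolyTimePred fun a => f a = g a :=
  ((le hf hg).and (le hg hf)).congr fun _ => le_antisymm_iff.symm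

end PolyTimePred

theorem PolyTime.card {n : α → ℕ} {S : ∀ a, Finset (Fin (n a))} (hn : PolyTime n)
    (hS : PolyTimePred fun s : Σ a, Fin (n a) => s.2 ∈ S s.1) : PolyTime fun a => (S a).card := by
  unfold PolyTimePred at hS
  simpa only [Finset.sum_boole, Finset.filter_univ_mem, Nat.cast_id] using
    hn.sum (f := fun a i => if i ∈ S a then 1 else 0) (by convert hS)

theorem PolyTimePred.exists {n : α → ℕ} {p : ∀ a, Fin (n a) → Prop} (hn : PolyTime n)
    (hp : PolyTimePred fun s : Σ a, Fin (n a) => p s.1 s.2) : PolyTimePred fun a => ∃ i, p a i := by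
  classical
  exact (lt (.const 0) (hn.card (S := fun a => Finset.univ.filter (p a))
    (hp.congr fun _ => by simp))).congr fun a => by simp [Finset.card_pos, Finset.Nonempty]

theorem PolyTimePred.forall {n : α → ℕ} {p : ∀ a, Fin (n a) → Prop} (hn : PolyTime n)
    (hp : PolyTimePred fun s : Σ a, Fin (n a) => p s.1 s.2) : PolyTimePred fun a => ∀ i, p a i :=
  (PolyTimePred.exists hn (p := fun a i => ¬ p a i) hp.not).not.congr fun a => by simp

namespace PolyTime

variable {f g h : α → ℕ}

theorem of_lt (hf : PolyTime f) (hle : ∀ a, h a ≤ f a)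
    (hlt : PolyTimePred fun s : Σ a, Fin (f a) => (s.2 : ℕ) < h s.1) : PolyTime h := by
  have hcard := hf.card (S := fun a => Finset.univ.filter fun i => (i : ℕ) < h a)
    (hlt.congr fun _ => by simp)
  simpa only [Fin.card_filter_val_lt, min_eq_right (hle _)] using hcard

theorem sqrt (hf : PolyTime f) : PolyTime fun a => Nat.sqrt (f a) :=
  hf.of_lt (fun _ => Nat.sqrt_le_self _) <|
    (PolyTimePred.le ((index.add (.const 1)).mul (index.add (.const 1))) hf.fst).congr fun _ =>
      Nat.le_sqrt.symm

theorem div (hf : PolyTime f) (hg : PolyTime g) : PolyTime fun a => f a / g a :=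
  hf.of_lt (fun _ => Nat.div_le_self _ _) <|
    ((PolyTimePred.lt (.const 0) hg.fst).and
      (.le ((index.add (.const 1)).mul hg.fst) hf.fst)).congr fun ⟨a, i⟩ => by
        rcases Nat.eq_zero_or_pos (g a) with hg0 | hpos
        · simp [hg0]
        · simp [hpos, ← Nat.succ_le_iff, Nat.le_div_iff_mul_le hpos]

theorem mod (hf : PolyTime f) (hg : PolyTime g) : PolyTime fun a => f a % g a := by
  simpa only [Nat.mod_eq_sub] using hf.sub (hg.mul (hf.div hg))

end PolyTime

theorem lt_orderEmbOfFin_iff {ι : Type*} [LinearOrder ι] {S : Finset ι} {k : ℕ} (h : S.card = k)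
    (i : Fin k) (w : ι) : w < S.orderEmbOfFin h i ↔ (S.filter (· ≤ w)).card ≤ i := by
  have hcard : (S.filter (· ≤ w)).card =
      (Finset.univ.filter fun j => S.orderEmbOfFin h j ≤ w).card := by
    rw [← Finset.card_map (S.orderEmbOfFin h).toEmbedding]
    congr 1
    ext u
    simp only [Finset.mem_filter, Finset.mem_map, Finset.mem_univ, true_and]
    constructor
    · rintro ⟨hu, huw⟩
      obtain ⟨j, rfl⟩ : u ∈ Set.range (S.orderEmbOfFin h) := by simpa using hu
      exact ⟨j, huw, rfl⟩
    · rintro ⟨j, hj, rfl⟩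
      exact ⟨S.orderEmbOfFin_mem h j, hj⟩
  rw [hcard]
  constructor
  · intro hw
    rw [← Fin.card_Iio i]
    exact Finset.card_le_card fun j hj => Finset.mem_Iio.2 <|
      (S.orderEmbOfFin h).lt_iff_lt.1 ((Finset.mem_filter.1 hj).2.trans_lt hw)
  · contrapose!
    intro hw
    rw [← Nat.succ_le_iff, Nat.succ_eq_add_one, ← Fin.card_Iic i]
    exact Finset.card_le_card fun j hj => Finset.mem_filter.2
      ⟨Finset.mem_univ j, ((S.orderEmbOfFin h).monotone (Finset.mem_Iic.1 hj)).trans hw⟩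

theorem PolyTime.orderEmbOfFin {n : α → ℕ} {S : ∀ a, Finset (Fin (n a))} {i : ∀ a, Fin (S a).card}
    (hn : PolyTime n) (hS : PolyTimePred fun s : Σ s : (Σ a, Fin (n a)), Fin (n s.1) =>
      s.2 ∈ S s.1.1) (hi : PolyTime fun a => (i a : ℕ)) :
    PolyTime fun a => ((S a).orderEmbOfFin rfl (i a) : ℕ) := by
  have hrank := hn.fst.card (S := fun s : Σ a, Fin (n a) => (S s.1).filter (· ≤ s.2))
    ((hS.and (.le index index.fst)).congr fun _ => by simp)
  exact hn.of_lt (fun _ => Fin.is_le') ((PolyTimePred.le hrank hi.fst).congr fun ⟨a, w⟩ =>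
    (lt_orderEmbOfFin_iff rfl (i a) w).symm)

end

/-! ### Writing the answer -/

section

/-- With a length in register `3`, append to the word, whose length is in register `0`, the values
that `p` computes in register `7` from the index in register `5`. -/
def appendLoop (p : Program) : Program :=
  .seq (copy 4 3) <| forLoop 4 <| .seq p <| .seq (.add 8 0 5) (.store 8 7)

/-- With lengths in the registers `0` and `3`, overwrite the memory from address `0` on with what is
stored behind the word. -/
def shiftLoop : Program :=
  .seq (copy 4 3) <| forLoop 4 <| .seq (.add 7 0 5) <| .seq (.load 7 7) (.store 5 7)

variable {c : Config} {g : ℕ → ℕ}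

theorem appendLoop_runs {p : Program} {T : ℕ}
    (hp : ∀ j < c.reg 3, ∀ d, (∀ s < 4, d.reg s = c.reg s) → (∀ i < c.reg 0, d.mem i = c.mem i) →
      d.reg 5 = j → Runs p d T fun e => AgreeBelow 7 d e ∧ e.reg 7 = g j) :
    Runs (appendLoop p) c (c.reg 3 * (T + 5) + 5) fun d =>
      (∀ s < 4, d.reg s = c.reg s) ∧ ∀ i < c.reg 3, d.mem (c.reg 0 + i) = g i := by
  have hcount : (c.setReg 4 (c.reg 3)).reg 4 = c.reg 3 := by simp
  refine Runs.mono (T := 2 + (c.reg 3 * (T + (1 + 1) + 3) + 3)) ?_ (by ring_nf; omega) fun _ h => h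
  refine .exec_seq (exec_copy (by omega) c) <| .mono (hcount ▸ forLoop_runs (I := fun j d =>
    (∀ s < 4, d.reg s = c.reg s) ∧ (∀ i < c.reg 0, d.mem i = c.mem i) ∧
      ∀ i < j, d.mem (c.reg 0 + i) = g i) ?_ ?_ ?_) le_rfl fun d hd => ⟨hd.1, hd.2.2⟩
  · rintro j d s x hs - ⟨hregs, hmem⟩
    exact ⟨fun i hi => by simp [show i ≠ s by omega, hregs i hi], hmem⟩
  · exact ⟨fun s hs => by simp [show s ≠ 4 by omega], by simp, by simp⟩
  · rintro j hj d ⟨hregs, hmem, hnew⟩ hindex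
    refine (hp j (hcount ▸ hj) d hregs hmem hindex).seq fun e ⟨hde, he⟩ =>
      .exec_seq (.add ..) <| .of_exec (.store ..) ⟨⟨?_, ?_, ?_⟩, ?_⟩
    all_goals simp only [Config.setMem_reg, Config.setReg_reg, Config.setMem_mem,
      Config.setReg_mem, if_pos, hde.mem]
    all_goals simp only [hde.reg 0 (by omega), hde.reg 5 (by omega), hregs 0 (by omega), hindex, he]
    · intro s hs
      simp [show s ≠ 8 by omega, hde.reg s (by omega), hregs s hs]
    · intro i hi
      simp [show i ≠ c.reg 0 + j by omega, hmem i hi]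
    · intro i hi
      rcases Nat.lt_succ_iff_lt_or_eq.1 hi with hi | rfl
      · simp [hi.ne, hnew i hi]
      · simp
    · intro s hs hs'
      simp [show s ≠ 8 by omega, hde.reg s (by omega)]

theorem shiftLoop_runs (hc : ∀ i < c.reg 3, c.mem (c.reg 0 + i) = g i) :
    Runs shiftLoop c (c.reg 3 * 6 + 5) fun d =>
      (∀ s < 4, d.reg s = c.reg s) ∧ ∀ i < c.reg 3, d.mem i = g i := by
  have hcount : (c.setReg 4 (c.reg 3)).reg 4 = c.reg 3 := by simp
  refine Runs.mono (T := 2 + (c.reg 3 * (1 + (1 + 1) + 3) + 3)) ?_ (by omega) fun _ h => h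
  refine .exec_seq (exec_copy (by omega) c) <| .mono (hcount ▸ forLoop_runs (I := fun j d =>
    (∀ s < 4, d.reg s = c.reg s) ∧ (∀ i < j, d.mem i = g i) ∧
      ∀ i < c.reg 3, j ≤ i → d.mem (c.reg 0 + i) = g i) ?_ ?_ ?_) le_rfl fun d hd => ⟨hd.1, hd.2.1⟩
  · rintro j d s x hs - ⟨hregs, hmem⟩
    exact ⟨fun i hi => by simp [show i ≠ s by omega, hregs i hi], hmem⟩
  · exact ⟨fun s hs => by simp [show s ≠ 4 by omega], by simp, fun i hi _ => hc i hi⟩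
  · rintro j hj d ⟨hregs, hdone, htodo⟩ hindex
    rw [hcount] at hj
    refine .exec_seq (.add ..) <| .exec_seq (.load ..) <| .of_exec (.store ..) ⟨⟨?_, ?_, ?_⟩, ?_⟩
    all_goals simp only [Config.setMem_reg, Config.setReg_reg, Config.setMem_mem,
      Config.setReg_mem, if_pos]
    all_goals simp only [show 5 ≠ 7 by omega, if_false, hregs 0 (by omega), hindex,
      htodo j hj le_rfl]
    · intro s hs
      simp [show s ≠ 7 by omega, hregs s hs]
    · intro i hi
      rcases Nat.lt_succ_iff_lt_or_eq.1 hi with hi | rfl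
      · simp [hi.ne, hdone i hi]
      · simp
    · intro i hi hji
      simp [show c.reg 0 + i ≠ j by omega, htodo i hi (by omega)]
    · intro s hs hs'
      simp [show s ≠ 7 by omega]

/-- With a length in register `3`, overwrite the memory from address `0` on with the values that `p`
computes; they are gathered behind the word first because `p` may read all of the word. -/
def writeLoop (p : Program) : Program := .seq (appendLoop p) shiftLoop

theorem writeLoop_runs {p : Program} {T : ℕ}
    (hp : ∀ j < c.reg 3, ∀ d, (∀ s < 4, d.reg s = c.reg s) → (∀ i < c.reg 0, d.mem i = c.mem i) →
      d.reg 5 = j → Runs p d T fun e => AgreeBelow 7 d e ∧ e.reg 7 = g j) :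
    Runs (writeLoop p) c (c.reg 3 * (T + 11) + 10) fun d =>
      (∀ s < 4, d.reg s = c.reg s) ∧ ∀ i < c.reg 3, d.mem i = g i := by
  refine Runs.mono (T := c.reg 3 * (T + 5) + 5 + (c.reg 3 * 6 + 5)) ?_ (by ring_nf; omega)
    fun _ h => h
  refine (appendLoop_runs hp).seq fun d ⟨hregs, hmem⟩ => ?_
  rw [← hregs 0 (by omega), ← hregs 3 (by omega)] at hmem
  rw [← hregs 3 (by omega)]
  exact (shiftLoop_runs hmem).mono le_rfl fun e he =>
    ⟨fun s hs => (he.1 s hs).trans (hregs s hs), he.2⟩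

end

end RAM

namespace Parameterized

open RAM Polynomial

theorem exists_eval_le_mul_pow (T : ℕ[X]) : ∃ a, ∀ N, T.eval N ≤ a * (N + 1) ^ a := by
  refine ⟨T.eval 1 + T.natDegree, fun N => ?_⟩
  calc T.eval N = ∑ i ∈ Finset.range (T.natDegree + 1), T.coeff i * N ^ i := eval_eq_sum_range N
    _ ≤ ∑ i ∈ Finset.range (T.natDegree + 1), T.coeff i * (N + 1) ^ T.natDegree := by
      refine Finset.sum_le_sum fun i hi => Nat.mul_le_mul_left _ ?_
      exact (Nat.pow_le_pow_left N.le_succ i).trans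
        (Nat.pow_le_pow_right N.succ_pos (Finset.mem_range_succ_iff.1 hi))
    _ = T.eval 1 * (N + 1) ^ T.natDegree := by simp [eval_eq_sum_range, Finset.sum_mul]
    _ ≤ _ := by gcongr <;> omega

theorem runsInPolyTime_of_runs {P : Program} {T U : ℕ[X]} {φ : List Bool → ℕ → Outcome}
    (hP : ∀ x k, Runs P (inputConfig x k) (T.eval (x.length + k)) fun d => outcomeOf d = φ x k)
    (hφ : ∀ x k, (φ x k).size ≤ U.eval (x.length + k)) : RunsInPolyTime P := by
  obtain ⟨a, ha⟩ := exists_eval_le_mul_pow (T + U)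
  refine ⟨a, fun x k => ?_⟩
  obtain ⟨t, d, hexec, ht, hd⟩ := hP x k
  refine ⟨t, φ x k, ⟨d, hexec, hd⟩, le_trans ?_ (ha _)⟩
  rw [eval_add]
  exact add_le_add ht (hφ x k)

theorem eq_of_answers {P : Program} {x : List Bool} {k t T : ℕ} {o o' : Outcome}
    (hP : Runs P (inputConfig x k) T fun d => outcomeOf d = o') (h : Answers P x k t o) :
    o = o' := by
  obtain ⟨_, d, hexec, -, rfl⟩ := hP
  obtain ⟨e, hexec', rfl⟩ := h
  rw [(hexec'.deterministic hexec).2]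

theorem stored_inputConfig (x : List Bool) (k : ℕ) :
    Stored (x, k) (push 1 fun _ => 0) 2 (inputConfig x k) :=
  ⟨fun _ _ => rfl, Nat.rec one_lt_two fun _ _ => two_pos, Nat.rec rfl fun _ _ => rfl⟩

theorem vars_le (x : List Bool) (k i : ℕ) : Environment.vars (x, k) i ≤ x.length + k := by
  cases i
  · exact Nat.le_add_left k _
  · exact Nat.le_add_right _ k

variable {len : List Bool × ℕ → ℕ} {p : ∀ I, Fin (len I) → Prop}

open Classical in
theorem exists_runs_write {code : List Bool × ℕ → ℕ} (hcode : PolyTime code) (hlen : PolyTime len)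
    (hp : PolyTimePred fun s : Σ I, Fin (len I) => p s.1 s.2) :
    ∃ (P : Program) (T : ℕ[X]), ∀ x k, Runs P (inputConfig x k) (T.eval (x.length + k)) fun d =>
      d.reg 0 = code (x, k) ∧ d.reg 1 = len (x, k) ∧ d.reg 2 = k ∧
        ∀ i : Fin (len (x, k)), d.mem i = if p (x, k) i then 1 else 0 := by
  obtain ⟨codeP, S, hcode⟩ := hcode
  obtain ⟨lenP, T, hlen⟩ := hlen
  obtain ⟨bitP, U, hbit⟩ := hp
  let v : ℕ → ℕ := push 1 fun _ => 0
  refine ⟨.seq (codeP v 2) <| .seq (lenP v 3) <| .seq (writeLoop (bitP (push 5 v) 7)) <|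
    .seq (copy 0 2) <| .seq (copy 2 1) (copy 1 3),
    S + (T + (T * (U.comp (X + T) + 11) + 10 + (2 + (2 + 2)))), fun x k => ?_⟩
  have hvars := vars_le x k
  generalize x.length + k = N at hvars
  obtain ⟨-, hcode⟩ := hcode (x, k) N hvars
  obtain ⟨hlen_le, hlen⟩ := hlen (x, k) N hvars
  have hvars' (j : Fin (len (x, k))) :
      ∀ i, Environment.vars (⟨(x, k), j⟩ : Σ I, Fin (len I)) i ≤ N + T.eval N :=
    Nat.rec (show (j : ℕ) ≤ _ by omega) fun i _ => (hvars i).trans (by omega)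
  simp only [eval_add, eval_mul, eval_comp, eval_X, eval_ofNat]
  refine (hcode v 2 _ (stored_inputConfig x k)).seq fun c ⟨hc, hccode⟩ =>
    (hlen v 3 c ((stored_inputConfig x k).of_agreeBelow hc (by omega))).seq fun d ⟨hd, hdlen⟩ => ?_
  have hstored := (stored_inputConfig x k).of_agreeBelow (hc.trans (hd.anti (by omega)))
    (show 2 ≤ 7 by omega)
  have hdcode : d.reg 2 = code (x, k) := (hd.reg 2 (by omega)).trans hccode
  have hdlength : d.reg 0 = x.length := hstored.reg 1
  have hdparam : d.reg 1 = k := hstored.reg 0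
  refine Runs.seq (.mono (writeLoop_runs (T := U.eval (N + T.eval N)) (g := fun j =>
    if h : j < len (x, k) then if p (x, k) ⟨j, h⟩ then 1 else 0 else 0) fun j hj e hregs hmem he =>
      ?_) (by rw [hdlen]; gcongr) fun _ h => h) fun e ⟨hregs, hmem⟩ =>
        .exec_seq (exec_copy (by omega) _) <| .exec_seq (exec_copy (by omega) _) <|
          .of_exec (exec_copy (by omega) _) ⟨?_, ?_, ?_, fun i => ?_⟩
  · rw [hdlen] at hj
    simp only [dif_pos hj]
    have hstored' : Stored (x, k) v 7 e :=
      ⟨fun i hi => (hmem i (hi.trans_eq hdlength.symm)).trans (hstored.mem i hi), hstored.lt,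
        Nat.rec ((hregs 1 (by omega)).trans hdparam) fun _ _ => (hregs 0 (by omega)).trans hdlength⟩
    exact (hbit ⟨(x, k), ⟨j, hj⟩⟩ _ (hvars' _)).2 _ _ e (hstored'.push (by omega) he)
  · simp [hregs 2, hdcode]
  · simp [hregs 3, hdlen]
  · simp [hregs 1, hdparam]
  · simp [hmem i (i.2.trans_eq hdlen.symm)]

open Classical in
/-- The answer "no" if `no` holds, "yes" if `yes` holds, and otherwise the instance whose word has
the bits `p I` and whose parameter is unchanged. -/
noncomputable def answer (no yes : List Bool × ℕ → Prop) (p : ∀ I, Fin (len I) → Prop)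
    (I : List Bool × ℕ) : Outcome :=
  if no I then .reject
  else if yes I then .accept
  else .reduced (List.ofFn fun i => decide (p I i)) I.2

theorem exists_program_answers {no yes : List Bool × ℕ → Prop} (hno : PolyTimePred no)
    (hyes : PolyTimePred yes) (hlen : PolyTime len)
    (hp : PolyTimePred fun s : Σ I, Fin (len I) => p s.1 s.2) :
    ∃ P, RunsInPolyTime P ∧
      ∀ x k t o, Answers P x k t o → o = answer no yes p (x, k) := by
  classical
  obtain ⟨P, T, hP⟩ := exists_runs_write (.ite hno (.const 0) (.ite hyes (.const 1) (.const 2)))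
    hlen hp
  have hrun (x k) : Runs P (inputConfig x k) (T.eval (x.length + k)) fun d =>
      outcomeOf d = answer no yes p (x, k) := by
    refine (hP x k).mono le_rfl fun d ⟨hcode, hlength, hparam, hmem⟩ => ?_
    have hword : (List.range (len (x, k))).map (fun i => decide (d.mem i ≠ 0)) =
        List.ofFn fun i => decide (p (x, k) i) :=
      List.ext_getElem (by simp) fun i hi _ => by
        simp [hmem ⟨i, by simpa using hi⟩]
    by_cases hno : no (x, k)
    · simp [outcomeOf, answer, hcode, hno]
    by_cases hyes : yes (x, k)
    · simp [outcomeOf, answer, hcode, hno, hyes]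
    · simp [outcomeOf, answer, hcode, hno, hyes, hlength, hparam, ← hword]
  obtain ⟨_, U, hU⟩ := hlen
  refine ⟨P, runsInPolyTime_of_runs (U := U + X + 1) hrun fun x k => ?_,
    fun x k t o => eq_of_answers (hrun x k)⟩
  have hlength := (hU (x, k) _ (vars_le x k)).1
  simp only [eval_add, eval_X, eval_one, answer]
  split_ifs <;> simp only [Outcome.size, List.length_ofFn] <;> omega

end Parameterized

namespace Parameterized

/-! ### Graphs given by a word -/

open SimpleGraph BColoring Finset

open scoped Classical

/-- The number of vertices of a graph whose adjacency matrix is written as `x`. -/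
def order (x : List Bool) : ℕ := Nat.sqrt x.length

/-- The graph on `n` vertices whose adjacency matrix is `x`; words that are not symmetric or have
nonzero bits on the diagonal are corrected. -/
def decodeGraph (n : ℕ) (x : List Bool) : SimpleGraph (Fin n) :=
  .fromRel fun u v => x.getD (u * n + v) false = true

/-- The graph whose adjacency matrix is `x`. -/
def graphOf (x : List Bool) : SimpleGraph (Fin (order x)) := decodeGraph (order x) x

section Encoding

variable {n : ℕ} {G : SimpleGraph (Fin n)} {x : List Bool} {d : ℕ}

theorem mul_add_lt (u v : Fin n) : (u * n + v : ℕ) < n * n := by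
  calc (u * n + v : ℕ) < u * n + n := by omega
    _ = (u + 1) * n := by ring
    _ ≤ n * n := Nat.mul_le_mul_right n u.2

theorem length_encodeGraph : (encodeGraph G).length = n * n := List.length_ofFn

theorem getD_encodeGraph (u v : Fin n) :
    (encodeGraph G).getD (u * n + v) false = true ↔ G.Adj u v := by
  have hu : (⟨u * n + v, mul_add_lt u v⟩ : Fin (n * n)).divNat = u := Fin.ext <| by
    simp [Fin.divNat, Nat.add_div_of_dvd_right, u.pos]
  have hv : (⟨u * n + v, mul_add_lt u v⟩ : Fin (n * n)).modNat = v := Fin.ext <| by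
    simp [Fin.modNat, Nat.mod_eq_of_lt v.2]
  rw [List.getD_eq_getElem _ _ (length_encodeGraph.symm ▸ mul_add_lt u v)]
  simp [encodeGraph, hu, hv]

theorem decodeGraph_encodeGraph : decodeGraph n (encodeGraph G) = G := by
  ext u v
  simp only [decodeGraph, fromRel_adj, getD_encodeGraph, G.adj_comm v u, or_self]
  exact and_iff_right_of_imp Adj.ne

theorem order_encodeGraph : order (encodeGraph G) = n := by
  rw [order, length_encodeGraph, Nat.sqrt_eq]

theorem exists_eq_graphOf (G : SimpleGraph (Fin n)) :
    ∃ x, encodeGraph (graphOf x) = x ∧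
      (⟨n, G⟩ : Σ n, SimpleGraph (Fin n)) = ⟨order x, graphOf x⟩ :=
  ⟨encodeGraph G, by rw [graphOf, order_encodeGraph, decodeGraph_encodeGraph], by
    rw [graphOf, order_encodeGraph, decodeGraph_encodeGraph]⟩

theorem mem_mDegreeBColoring_iff : (x, d) ∈ mDegreeBColoring ↔
    encodeGraph (graphOf x) = x ∧ (graphOf x).maxDeg = d ∧
      (graphOf x).HasBColoring (graphOf x).mDegree := by
  constructor
  · rintro ⟨n, G, hI, hG⟩
    obtain ⟨y, hy, h⟩ := exists_eq_graphOf G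
    cases h
    obtain ⟨rfl, rfl⟩ := Prod.mk.inj hI
    rw [hy]
    exact ⟨hy, rfl, hG⟩
  · rintro ⟨hx, rfl, hG⟩
    exact ⟨_, graphOf x, by rw [hx], hG⟩

theorem encodeGraph_decodeGraph_iff : encodeGraph (decodeGraph n x) = x ↔
    x.length = n * n ∧ ∀ u v : Fin n,
      x.getD (u * n + v) false = true ↔ (decodeGraph n x).Adj u v := by
  constructor
  · intro hx
    rw [← hx]
    exact ⟨length_encodeGraph, fun u v => by rw [getD_encodeGraph, decodeGraph_encodeGraph]⟩
  · rintro ⟨hlen, hx⟩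
    refine List.ext_getElem (length_encodeGraph.trans hlen.symm) fun i hi hi' => ?_
    let j : Fin (n * n) := ⟨i, hlen ▸ hi'⟩
    have hj : (j.divNat * n + j.modNat : ℕ) = i := Nat.div_add_mod' i n
    have hbit := hx j.divNat j.modNat
    rw [hj, List.getD_eq_getElem _ _ hi'] at hbit
    simp [encodeGraph, j, ← hbit]

end Encoding

/-! ### Computing with the graph given by a word -/

open RAM Environment

section PolyTime

variable {β : Type} [Environment β]

theorem order_mul_order_le (x : List Bool) : order x * order x ≤ x.length := Nat.sqrt_le _

theorem polyTime_order : PolyTime fun b : β => order (word b) := PolyTime.length_word.sqrt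

variable {u v : ∀ b : β, Fin (order (word b))}

theorem polyTimePred_bit (hu : PolyTime fun b => (u b : ℕ)) (hv : PolyTime fun b => (v b : ℕ)) :
    PolyTimePred fun b => (word b).getD (u b * order (word b) + v b) false = true :=
  .getD_word ((hu.mul polyTime_order).add hv) fun b =>
    (mul_add_lt (u b) (v b)).trans_le (order_mul_order_le _)

theorem polyTimePred_adj (hu : PolyTime fun b => (u b : ℕ)) (hv : PolyTime fun b => (v b : ℕ)) :
    PolyTimePred fun b => (graphOf (word b)).Adj (u b) (v b) :=
  ((PolyTimePred.eq hu hv).not.and ((polyTimePred_bit hu hv).or (polyTimePred_bit hv hu))).congr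
    fun _ => and_congr_left' Fin.val_inj.not

theorem polyTime_degree (hv : PolyTime fun b => (v b : ℕ)) :
    PolyTime fun b => (graphOf (word b)).degree (v b) :=
  polyTime_order.card <| (polyTimePred_adj hv.fst .index).congr fun _ =>
    (mem_neighborFinset _ _ _).symm

theorem polyTime_card_dense {i : β → ℕ} (hi : PolyTime i) :
    PolyTime fun b => #(dense (graphOf (word b)) (i b)) :=
  polyTime_order.card <| (PolyTimePred.le hi.fst ((polyTime_degree .index).add (.const 1))).congr
    fun _ => mem_dense.symm

theorem polyTime_mDegree : PolyTime fun b : β => (graphOf (word b)).mDegree :=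
  polyTime_order.of_lt (fun _ => mDegree_le_card.trans_eq (Fintype.card_fin _)) <|
    (PolyTimePred.le (PolyTime.index.add (.const 1))
      (polyTime_card_dense (PolyTime.index.add (.const 1)))).congr fun _ => le_mDegree_iff.symm

theorem polyTime_maxDeg : PolyTime fun b : β => (graphOf (word b)).maxDeg :=
  polyTime_order.of_lt (fun _ => maxDeg_le_card.trans_eq (Fintype.card_fin _)) <|
    (PolyTimePred.exists polyTime_order
      (.lt (PolyTime.index.fst) (polyTime_degree .index))).congr fun _ => lt_maxDeg_iff.symm

theorem polyTimePred_mem_core (hv : PolyTime fun b => (v b : ℕ)) :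
    PolyTimePred fun b => v b ∈ core (graphOf (word b)) := by
  refine (PolyTimePred.exists polyTime_order
    (p := fun b w => (graphOf (word b)).mDegree ≤ (graphOf (word b)).degree w + 1 ∧
      ((graphOf (word b)).Adj w (v b) ∨ (w : ℕ) = v b))
    ((PolyTimePred.le polyTime_mDegree ((polyTime_degree .index).add (.const 1))).and
      ((polyTimePred_adj .index hv.fst).or (.eq .index hv.fst)))).congr fun b => ?_
  simp only [core, mem_closedNbhdOf, mem_dense, mem_closedNbhd, Fin.val_inj]

theorem polyTime_card_core : PolyTime fun b : β => #(core (graphOf (word b))) :=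
  polyTime_order.card (polyTimePred_mem_core .index)

theorem polyTimePred_encodeGraph_graphOf_eq :
    PolyTimePred fun b : β => encodeGraph (graphOf (word b)) = word b :=
  ((PolyTimePred.eq .length_word (polyTime_order.mul polyTime_order)).and
    (.forall polyTime_order (.forall polyTime_order
      ((polyTimePred_bit PolyTime.index.fst .index).iff
        (polyTimePred_adj PolyTime.index.fst .index))))).congr
    fun _ => encodeGraph_decodeGraph_iff.symm

end PolyTime

/-! ### The kernel -/

/-- The subgraph induced by the core, with its vertices renumbered in increasing order. -/
noncomputable def kernelGraph {n : ℕ} (G : SimpleGraph (Fin n)) : SimpleGraph (Fin #(core G)) :=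
  G.comap ((core G).orderEmbOfFin rfl)

section Kernel

variable {n : ℕ} {G : SimpleGraph (Fin n)}

theorem exists_kernelGraph_embedding (G : SimpleGraph (Fin n)) :
    ∃ e : kernelGraph G ↪g G, (core G : Set (Fin n)) ⊆ Set.range e :=
  ⟨.comap ((core G).orderEmbOfFin rfl).toEmbedding G, ((core G).range_orderEmbOfFin rfl).ge⟩

theorem maxDeg_kernelGraph : (kernelGraph G).maxDeg = G.maxDeg :=
  maxDeg_eq_of_embedding (exists_kernelGraph_embedding G).choose_spec

theorem hasBColoring_kernelGraph_iff :
    (kernelGraph G).HasBColoring (kernelGraph G).mDegree ↔ G.HasBColoring G.mDegree :=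
  hasBColoring_mDegree_iff_of_embedding (exists_kernelGraph_embedding G).choose_spec

theorem mem_mDegreeBColoring : (encodeGraph G, G.maxDeg) ∈ mDegreeBColoring ↔
    G.HasBColoring G.mDegree := by
  obtain ⟨x, hx, h⟩ := exists_eq_graphOf G
  cases h
  simp only [mem_mDegreeBColoring_iff, hx, true_and]

end Kernel

/-- The answer of the kernelization algorithm. -/
noncomputable def kernelAnswer : List Bool × ℕ → Outcome :=
  answer (fun I => ¬ (encodeGraph (graphOf I.1) = I.1 ∧ (graphOf I.1).maxDeg = I.2))
    (fun I => 6 * ((graphOf I.1).mDegree ^ 4 * (graphOf I.1).maxDeg) < #(core (graphOf I.1)))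
    (len := fun I => #(core (graphOf I.1)) * #(core (graphOf I.1)))
    fun I i => (kernelGraph (graphOf I.1)).Adj i.divNat i.modNat

theorem exists_program_kernelAnswer :
    ∃ P, RunsInPolyTime P ∧ ∀ x k t o, Answers P x k t o → o = kernelAnswer (x, k) := by
  have hm : PolyTime fun I : List Bool × ℕ => (graphOf I.1).mDegree := polyTime_mDegree
  have hcore : PolyTime fun I : List Bool × ℕ => #(core (graphOf I.1)) := polyTime_card_core
  refine exists_program_answers
    (polyTimePred_encodeGraph_graphOf_eq.and (.eq polyTime_maxDeg (.var 0))).not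
    ((PolyTimePred.lt ((PolyTime.const 6).mul
      ((((hm.mul hm).mul (hm.mul hm)).mul polyTime_maxDeg))) hcore).congr fun _ => ?_)
    (hcore.mul hcore)
    (polyTimePred_adj (polyTime_order.orderEmbOfFin (polyTimePred_mem_core .index) ?_)
      (polyTime_order.orderEmbOfFin (polyTimePred_mem_core .index) ?_))
  · rw [← sq, ← sq, ← pow_mul]
    rfl
  · exact PolyTime.index.div polyTime_card_core
  · exact PolyTime.index.mod polyTime_card_core

theorem kernelAnswer_encodeGraph {n : ℕ} (G : SimpleGraph (Fin n)) :
    kernelAnswer (encodeGraph G, G.maxDeg) =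
      if 6 * (G.mDegree ^ 4 * G.maxDeg) < #(core G) then .accept
      else .reduced (encodeGraph (kernelGraph G)) G.maxDeg := by
  obtain ⟨x, hx, h⟩ := exists_eq_graphOf G
  cases h
  rw [hx, kernelAnswer, answer, if_neg (not_not.2 ⟨hx, rfl⟩)]
  split_ifs <;> rfl

theorem card_core_le_mul_maxDeg_pow {n : ℕ} {G : SimpleGraph (Fin n)}
    (h : #(core G) ≤ 6 * (G.mDegree ^ 4 * G.maxDeg)) : #(core G) ≤ 96 * G.maxDeg ^ 5 := by
  linarith [mDegree_pow_four_mul_maxDeg_le (G := G)]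

/-- A bound on the size of the kernel of a graph of maximum degree `d`. -/
def sizeBound (d : ℕ) : ℕ := (96 * d ^ 5) * (96 * d ^ 5) + d

theorem computable_sizeBound : Computable sizeBound := by
  have hpow : Primrec fun d : ℕ => 96 * d ^ 5 := by
    have hsq : Primrec fun d : ℕ => d * d := Primrec.nat_mul.comp .id .id
    exact (Primrec.nat_mul.comp (.const 96) (Primrec.nat_mul.comp
      (Primrec.nat_mul.comp hsq hsq) .id)).of_eq fun d => by
        simp only [id]; ring
  exact (Primrec.nat_add.comp (Primrec.nat_mul.comp hpow hpow) .id).to_comp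

theorem isCorrect_kernelAnswer (x : List Bool) (d : ℕ) :
    (kernelAnswer (x, d)).IsCorrect mDegreeBColoring sizeBound x d := by
  by_cases hvalid : encodeGraph (graphOf x) = x ∧ (graphOf x).maxDeg = d
  · obtain ⟨n, G, rfl, rfl⟩ : ∃ (n : ℕ) (G : SimpleGraph (Fin n)),
        x = encodeGraph G ∧ d = G.maxDeg := ⟨_, graphOf x, hvalid.1.symm, hvalid.2.symm⟩
    rw [kernelAnswer_encodeGraph]
    split_ifs with h
    · exact mem_mDegreeBColoring.2 (hasBColoring_of_lt_card_core h)
    · have hcard := card_core_le_mul_maxDeg_pow (not_lt.1 h)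
      refine ⟨?_, ?_⟩
      · rw [length_encodeGraph]
        exact Nat.add_le_add_right (Nat.mul_le_mul hcard hcard) _
      · rw [mem_mDegreeBColoring, ← maxDeg_kernelGraph, mem_mDegreeBColoring,
          hasBColoring_kernelGraph_iff]
  · have hreject : kernelAnswer (x, d) = .reject := if_pos hvalid
    rw [hreject]
    exact fun h => hvalid ((mem_mDegreeBColoring_iff.1 h).imp_right And.left)

end Parameterized

theorem mainTheorem10 :
    ∃ P : RAM.Program,
      Parameterized.IsKernelization P Parameterized.mDegreeBColoring ∧
      ∃ C : ℕ, ∀ (n : ℕ) (G : SimpleGraph (Fin n)) (t : ℕ) (x' : List Bool) (k' : ℕ),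
        Parameterized.Answers P (Parameterized.encodeGraph G) G.maxDeg t
          (Parameterized.Outcome.reduced x' k') →
        ∃ (n' : ℕ) (G' : SimpleGraph (Fin n')),
          x' = Parameterized.encodeGraph G' ∧ k' = G'.maxDeg ∧
          n' ≤ C * (G.mDegree ^ 4 * G.maxDeg) ∧ n' ≤ C * G.maxDeg ^ 5 := by
  obtain ⟨P, hpoly, hanswer⟩ := Parameterized.exists_program_kernelAnswer
  refine ⟨P, ⟨hpoly, Parameterized.sizeBound, Parameterized.computable_sizeBound,
    fun x d t o h => hanswer x d t o h ▸ Parameterized.isCorrect_kernelAnswer x d⟩, 96,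
    fun n G t x' k' h => ?_⟩
  have hreduced := hanswer _ _ t _ h
  rw [Parameterized.kernelAnswer_encodeGraph] at hreduced
  split_ifs at hreduced with hcard
  obtain ⟨rfl, rfl⟩ := Parameterized.Outcome.reduced.inj hreduced
  have hcore := not_lt.1 hcard
  exact ⟨_, Parameterized.kernelGraph G, rfl, Parameterized.maxDeg_kernelGraph.symm,
    hcore.trans (Nat.mul_le_mul_right _ (by omega)),
    Parameterized.card_core_le_mul_maxDeg_pow hcore⟩
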